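/- **Setting.** For $d\ge 1$ let $\mathcal S^d$ and $\mathcal S^d_{++}$ be the real symmetric and the symmetric positive definite $d\times d$ matrices, $\|\cdot\|_F$ the Frobenius norm, $\|\cdot\|_2$ the spectral norm, $\|Z\|_1=\sum_{i,j}|Z_{ij}|$. For a positive semidefinite $\widehat\Sigma$ and $\rho,\lambda>0$ let $$f(\Theta,Z)=-\log\det\Theta+\operatorname{tr}(\widehat\Sigma\Theta)+\rho\|Z\|_1+\tfrac{\lambda}{2}\|Z-\Theta\|_F^2 ,$$ and let $(\widehat\Theta_\lambda,\widehat Z_\lambda)$ be its minimizer over $\Theta\in\mathcal S^d_{++}$, $Z\in\mathcal S^d$. Alternating minimization (AM), started at some $Z_0\in\mathcal S^d$, is $$\Theta_{k+1}=\tfrac12\Bigl(-Y+\sqrt{Y^\top Y+\tfrac4\lambda I}\Bigr),\quad Y=\tfrac1\lambda\widehat\Sigma-Z_k,\qquad Z_{k+1}=\eta_{\rho/\lambda}(\Theta_{k+1}),$$ with entrywise soft thresholding $\eta_t(x)=\operatorname{sign}(x)\max(|x|-t,0)$. Fix $0<\epsilon_1\le\epsilon_2$, $c_{\widehat\Sigma}$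 and $z_0\ge0$; every AM run below starts with $\|Z_0\|_2\le z_0$. **(1) Linear convergence.** For all $d$ and $\rho,\lambda>0$ there is $C\in(0,1)$ such that for every positive semidefinite $\widehat\Sigma$ with $\|\widehat\Sigma\|_2\le c_{\widehat\Sigma}$: the minimizer $(\widehat\Theta_\lambda,\widehat Z_\lambda)$ exists and is unique; any minimizer of $f$ over $\mathcal S^d_{++}\times\mathcal S^d_{++}$ coincides with it; and every AM run satisfies, for all $k\ge0$, $$\|Z_{k+1}-\widehat Z_\lambda\|_F\le\|\Theta_{k+1}-\widehat\Theta_\lambda\|_F\le C\,\|Z_k-\widehat Z_\lambda\|_F .$$ **(2) Recovery.** Let $\widehat\Sigma$ be the sample covariance matrix of $m\ge1$ independent samples of $N(\nu,\Sigma^*)$ in dimension $d\ge2$ (any mean $\nu$), where the eigenvalues of $\Sigma^*$ lie in $[\epsilon_1,\epsilon_2]$ and $\Theta^*=(\Sigma^*)^{-1}$ has at most $s$ nonzero off-diagonal entries. Put $$r=\sqrt{\frac{(\log d)/m}{\min\bigl(\frac1{d+s},\frac{\lambda}{d^2}\bigr)}} .$$ There are numbers $0<C_\lambda<1$ ($\lambda>0$),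 depending only on $\lambda$ and on $\epsilon_1,\epsilon_2,c_{\widehat\Sigma},z_0$, and a threshold $a_0>0$, depending only on $\epsilon_1,\epsilon_2,c_{\widehat\Sigma},z_0$, such that the following holds for all $0<a\le b$ and all $\rho$ with $a\sqrt{(\log d)/m}\le\rho\le b\sqrt{(\log d)/m}$. (a) For fixed $\lambda$, in the regime $r\to0$ (in which $d$, $s$, $m$, $\Sigma^*$, $\nu$ and $\rho$ may all vary), with an error term that is uniform over all AM runs and all $k$, $$\|\Theta_k-\Theta^*\|_F\le C_\lambda\|\Theta_{k-1}-\widehat\Theta_\lambda\|_F+\mathcal O_{\mathbb P}(r),\qquad \|\Theta_k-\widehat\Theta_\lambda\|_F\le C_\lambda\|\Theta_{k-1}-\widehat\Theta_\lambda\|_F .$$ Precisely: for every $\delta>0$ there are $M=M_\lambda>0$ and $r_0=r_0(\lambda)>0$, not depending on $d,s,m,\Sigma^*,\nu,\rho$, such that if $r\le r_0$ then, outside an event of probability at most $\delta$, both inequalities, with $Mr$ in place of $\mathcal O_{\mathbb P}(r)$, hold for every AM run and every $k\ge2$, and also for $k=1$ if $Z_0=\eta_{\rho/\lambda}(\Theta_0)$.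 If $a\ge a_0$, then $M$ can be chosen independently of $\lambda$. (b) If $a\ge a_0$, the error term is uniform in $\lambda$ as well: for every $\delta>0$ there are $M,r_0>0$, not depending on $\lambda,d,s,m,\Sigma^*,\nu,\rho$, such that $r\le r_0$ implies $\|\widehat\Theta_\lambda-\Theta^*\|_F\le M r$ outside an event of probability at most $\delta$. -/

import Mathlib

open MeasureTheory ProbabilityTheory

namespace GLAD

noncomputable section

/-- Real `d × d` matrices. -/
abbrev Mat (d : ℕ) : Type := Matrix (Fin d) (Fin d) ℝ

/-- The Frobenius norm. -/
def frob {d : ℕ} (A : Mat d) : ℝ := Real.sqrt (∑ i, ∑ j, A i j ^ 2)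

/-- The spectral norm: the operator norm on Euclidean space. -/
def specNorm {d : ℕ} (A : Mat d) : ℝ := ‖Matrix.toEuclideanCLM (𝕜 := ℝ) A‖

/-- The entrywise `ℓ₁` norm (diagonal included). -/
def l1 {d : ℕ} (A : Mat d) : ℝ := ∑ i, ∑ j, |A i j|

/-- Symmetric positive definite matrices. -/
def spd (d : ℕ) : Set (Mat d) := {A | A.PosDef}

/-- Symmetric matrices. -/
def sym (d : ℕ) : Set (Mat d) := {A | A.IsSymm}

/-- The quadratic-penalty objective
`-log det Θ + tr (S Θ) + ρ ‖Z‖₁ + (lam / 2) ‖Z - Θ‖_F²`, where `S` is the sample covariance. -/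
def objective {d : ℕ} (S : Mat d) (ρ lam : ℝ) (p : Mat d × Mat d) : ℝ :=
  -Real.log p.1.det + (S * p.1).trace + ρ * l1 p.2 + lam / 2 * frob (p.2 - p.1) ^ 2

/-- `p = (Θ, Z)` minimizes the quadratic-penalty objective over `Θ ∈ spd d`, `Z ∈ D`. -/
def IsPenaltyMin {d : ℕ} (S : Mat d) (ρ lam : ℝ) (D : Set (Mat d)) (p : Mat d × Mat d) : Prop :=
  p ∈ spd d ×ˢ D ∧ IsMinOn (objective S ρ lam) (spd d ×ˢ D) p

/-- Entrywise soft thresholding at level `t`. -/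
def softThreshold {d : ℕ} (t : ℝ) (A : Mat d) : Mat d :=
  A.map fun x => Real.sign x * max (|x| - t) 0

open scoped MatrixOrder in
/-- `(-Y + √(Yᵀ Y + (4 / lam) I)) / 2`, with the positive semidefinite square root. -/
def thetaOfY {d : ℕ} (lam : ℝ) (Y : Mat d) : Mat d :=
  (1 / 2 : ℝ) • (-Y + CFC.sqrt (Y.transpose * Y + (4 / lam) • (1 : Mat d)))

/-- `Θ, Z` are the iterates of alternating minimization. The start `Θ 0`, `Z 0` is free. -/
def IsAM {d : ℕ} (S : Mat d) (ρ lam : ℝ) (Θ Z : ℕ → Mat d) : Prop :=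
  ∀ k, Θ (k + 1) = thetaOfY lam ((1 / lam) • S - Z k) ∧
    Z (k + 1) = softThreshold (ρ / lam) (Θ (k + 1))

/-- The sample mean. -/
def sampleMean {d m : ℕ} (x : Fin m → EuclideanSpace ℝ (Fin d)) (i : Fin d) : ℝ :=
  (∑ l, x l i) / m

/-- The sample covariance matrix of the observations `x 0, …, x (m - 1)`. -/
def sampleCov {d m : ℕ} (x : Fin m → EuclideanSpace ℝ (Fin d)) : Mat d :=
  Matrix.of fun i j =>
    (∑ l, (x l i - sampleMean x i) * (x l j - sampleMean x j)) / m

/-- The true covariance matrix `S` has its spectrum in `[ε₁, ε₂]`, and the true precision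
matrix `S⁻¹` has at most `s` nonzero off-diagonal entries. -/
structure TrueModel {d : ℕ} (ε₁ ε₂ : ℝ) (s : ℕ) (S : Mat d) : Prop where
  herm : S.IsHermitian
  spec : ∀ i, ε₁ ≤ herm.eigenvalues i ∧ herm.eigenvalues i ≤ ε₂
  sparse : Set.ncard {q : Fin d × Fin d | q.1 ≠ q.2 ∧ S⁻¹ q.1 q.2 ≠ 0} ≤ s

/-- `X 0, …, X (m - 1)` are independent Gaussian vectors with mean `ν` and covariance `S`. -/
structure IsGaussianSample {d m : ℕ} {Ω : Type*} [MeasurableSpace Ω] (P : Measure Ω)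
    (ν : EuclideanSpace ℝ (Fin d)) (S : Mat d) (X : Fin m → Ω → EuclideanSpace ℝ (Fin d)) :
    Prop where
  law : ∀ l, HasLaw (X l) (multivariateGaussian ν S) P
  indep : iIndepFun X P

/-- The rate `√((log d / m) / min (1 / (d + s)) (lam / d²))`. -/
def rate (d s m : ℕ) (lam : ℝ) : ℝ :=
  Real.sqrt ((Real.log d / m) / min (1 / ((d : ℝ) + s)) (lam / (d : ℝ) ^ 2))

end

end GLAD

/-! Write Θ⁺ for the update of Z. It is the positive definite root of λΘ⁺ - (Θ⁺)⁻¹ = λZ - S.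
Subtracting two such equations and pairing with D = Θ₁ - Θ₂ gives λ‖D‖² + tr(D Θ₁⁻¹ D Θ₂⁻¹) = λ⟨Z₁ -
Z₂, D⟩. If both updates lie below B in the Loewner order, the trace is at least B⁻²‖D‖², so the step
contracts by λ/(λ + B⁻²) (`IsThetaStep.contraction`). Soft thresholding is nonexpansive. Minimizers
are exactly the fixed points of a sweep (`isFixed_iff_isPenaltyMin`), so linear convergence reduces
to finding B: coercivity supplies one for given d, ρ, λ, uniformly over S.

For recovery, B must not depend on the dimension. When S ⪰ e and dρ is small, the linear term leaves
enough slack in the Θ-update to undo the spectral growth caused by thresholding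
(`IsAM.upper_bound`).

The statistical error comes from the stationarity equation at the minimizer, whose penalty part is
the residual λ(Θ - Z), with entries at most ρ (`IsFixed.basic_inequality`). Bounding noise and
residual crudely gives an error of order d(w + ρ), where w bounds the entries of the noise; this is
at most √λ times the rate (`IsFixed.frob_sub_le_dense`). For a bound free of λ, note that the
residual is the derivative of a Huber function: off the support of the truth it offsets noise of
size at most ρ, up to ρ²/λ per entry (`IsFixed.frob_sub_le_sparse`).

The entrywise noise is controlled by Chernoff bounds for Gaussian linear forms and their squares,
through polarization (`IsGaussianSample.measure_deviation_le`). -/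

namespace GLAD

open Matrix

universe u

noncomputable section

/-! ### Frobenius norm and inner product. -/

section Deterministic

variable {d : ℕ}

/-- The Frobenius inner product. -/
def frobInner (A B : Mat d) : ℝ := ∑ i, ∑ j, A i j * B i j

/-- The entries of a matrix as a Euclidean vector. -/
def vecE (A : Mat d) : EuclideanSpace ℝ (Fin d × Fin d) := WithLp.toLp 2 fun q => A q.1 q.2

lemma frob_eq_norm (A : Mat d) : frob A = ‖vecE A‖ := by
  simp [frob, vecE, EuclideanSpace.norm_eq, Fintype.sum_prod_type]

lemma vecE_sub (A B : Mat d) : vecE (A - B) = vecE A - vecE B := by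
  ext q; simp [vecE]

lemma vecE_add (A B : Mat d) : vecE (A + B) = vecE A + vecE B := by
  ext q; simp [vecE]

lemma frobInner_eq_inner (A B : Mat d) : frobInner A B = inner ℝ (vecE A) (vecE B) := by
  simp [frobInner, vecE, PiLp.inner_apply, Fintype.sum_prod_type, mul_comm]

lemma frob_nonneg (A : Mat d) : 0 ≤ frob A := Real.sqrt_nonneg _

lemma frob_sq (A : Mat d) : frob A ^ 2 = ∑ i, ∑ j, A i j ^ 2 :=
  Real.sq_sqrt (by positivity)

lemma frobInner_self (A : Mat d) : frobInner A A = frob A ^ 2 := by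
  rw [frob_sq]
  simp [frobInner, pow_two]

lemma frobInner_le (A B : Mat d) : frobInner A B ≤ frob A * frob B := by
  rw [frobInner_eq_inner, frob_eq_norm, frob_eq_norm]
  exact real_inner_le_norm _ _

lemma frobInner_comm (A B : Mat d) : frobInner A B = frobInner B A := by
  simp [frobInner, mul_comm]

lemma frobInner_add_left (A B C : Mat d) :
    frobInner (A + B) C = frobInner A C + frobInner B C := by
  simp [frobInner, add_mul, Finset.sum_add_distrib]

lemma frobInner_sub_left (A B C : Mat d) :
    frobInner (A - B) C = frobInner A C - frobInner B C := by
  simp [frobInner, sub_mul, Finset.sum_sub_distrib]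

lemma frobInner_smul_left (c : ℝ) (A B : Mat d) :
    frobInner (c • A) B = c * frobInner A B := by
  simp [frobInner, Finset.mul_sum, mul_assoc]

lemma frobInner_neg_left (A B : Mat d) : frobInner (-A) B = -frobInner A B := by
  simp [frobInner]

lemma frobInner_eq_trace (A : Mat d) {B : Mat d} (hB : B.IsSymm) :
    frobInner A B = (A * B).trace := by
  simp only [frobInner, trace, diag, mul_apply]
  exact Finset.sum_congr rfl fun i _ => Finset.sum_congr rfl fun j _ => by rw [hB.apply]

lemma frob_sub_le (A B C : Mat d) : frob (A - C) ≤ frob (A - B) + frob (B - C) := by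
  simp only [frob_eq_norm, vecE_sub]
  exact norm_sub_le_norm_sub_add_norm_sub _ _ _

lemma frob_add_le (A B : Mat d) : frob (A + B) ≤ frob A + frob B := by
  simp only [frob_eq_norm, vecE_add]
  exact norm_add_le _ _

lemma frob_sub_comm (A B : Mat d) : frob (A - B) = frob (B - A) := by
  simp only [frob_eq_norm, vecE_sub]
  exact norm_sub_rev _ _

lemma frob_eq_zero {A : Mat d} (h : frob A = 0) : A = 0 := by
  have : vecE A = 0 := by rwa [frob_eq_norm, norm_eq_zero] at h
  ext i j
  simpa [vecE] using congrArg (fun v => v.ofLp (i, j)) this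

lemma frob_le_frob_of_abs_le {A B : Mat d} (h : ∀ i j, |A i j| ≤ |B i j|) : frob A ≤ frob B :=
  Real.sqrt_le_sqrt <| Finset.sum_le_sum fun i _ => Finset.sum_le_sum fun j _ =>
    sq_le_sq.2 (h i j)

lemma frob_le_of_abs_le {A : Mat d} {t : ℝ} (ht : 0 ≤ t) (h : ∀ i j, |A i j| ≤ t) :
    frob A ≤ d * t := by
  refine Real.sqrt_le_iff.2 ⟨by positivity, ?_⟩
  calc ∑ i, ∑ j, A i j ^ 2 ≤ ∑ _i : Fin d, ∑ _j : Fin d, t ^ 2 :=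
        Finset.sum_le_sum fun i _ => Finset.sum_le_sum fun j _ => by
          rw [← sq_abs]; exact pow_le_pow_left₀ (abs_nonneg _) (h i j) 2
    _ = (d * t) ^ 2 := by simp; ring

lemma abs_le_frob (A : Mat d) (i j : Fin d) : |A i j| ≤ frob A := by
  rw [frob_eq_norm]
  simpa [vecE] using PiLp.norm_apply_le (vecE A) (i, j)

lemma frob_le_l1 (A : Mat d) : frob A ≤ l1 A := by
  refine Real.sqrt_le_iff.2 ⟨by unfold l1; positivity, ?_⟩
  have h := Finset.sum_sq_le_sq_sum_of_nonneg (s := (Finset.univ : Finset (Fin d × Fin d)))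
    (f := fun q => |A q.1 q.2|) (fun _ _ => abs_nonneg _)
  simpa [l1, Fintype.sum_prod_type] using h

/-! ### Positive semidefinite matrices -/

lemma isSymm_of_isHermitian {A : Mat d} (h : A.IsHermitian) : A.IsSymm := by
  simpa [IsHermitian, IsSymm, conjTranspose_eq_transpose_of_trivial] using h

lemma isHermitian_of_isSymm {A : Mat d} (h : A.IsSymm) : A.IsHermitian := by
  simpa [IsHermitian, IsSymm, conjTranspose_eq_transpose_of_trivial] using h

lemma isSymm_of_posSemidef {A : Mat d} (h : A.PosSemidef) : A.IsSymm :=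
  isSymm_of_isHermitian h.isHermitian

lemma isSymm_of_posDef {A : Mat d} (h : A.PosDef) : A.IsSymm :=
  isSymm_of_posSemidef h.posSemidef

lemma posSemidef_conj {A B : Mat d} (hA : A.PosSemidef) (hB : B.IsSymm) :
    (B * A * B).PosSemidef := by
  have := hA.mul_mul_conjTranspose_same B
  rwa [(isHermitian_of_isSymm hB).eq] at this

lemma exists_conjTranspose_mul_self {B : Mat d} (hB : B.PosSemidef) :
    ∃ C : Mat d, B = Cᴴ * C := by
  open scoped MatrixOrder in
  exact CStarAlgebra.nonneg_iff_eq_star_mul_self.1 hB.nonneg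

lemma trace_mul_nonneg {A B : Mat d} (hA : A.PosSemidef) (hB : B.PosSemidef) :
    0 ≤ (A * B).trace := by
  obtain ⟨C, rfl⟩ := exists_conjTranspose_mul_self hB
  rw [← mul_assoc, trace_mul_comm, ← mul_assoc]
  exact (hA.mul_mul_conjTranspose_same C).trace_nonneg

lemma posSemidef_smul_one_sub {A : Mat d} (hA : A.IsSymm) {c : ℝ}
    (h : ∀ x : Fin d → ℝ, x ⬝ᵥ A *ᵥ x ≤ c * (x ⬝ᵥ x)) : (c • (1 : Mat d) - A).PosSemidef := by
  refine PosSemidef.of_dotProduct_mulVec_nonneg ?_ fun x => ?_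
  · exact isHermitian_of_isSymm (by simp [IsSymm, hA.eq])
  · simpa [sub_mulVec, smul_mulVec, dotProduct_sub] using h x

lemma dotProduct_le_of_posSemidef {A : Mat d} {c : ℝ} (h : (c • (1 : Mat d) - A).PosSemidef)
    (x : Fin d → ℝ) : x ⬝ᵥ A *ᵥ x ≤ c * (x ⬝ᵥ x) := by
  have := h.dotProduct_mulVec_nonneg x
  simpa [sub_mulVec, smul_mulVec, dotProduct_sub] using this

lemma dotProduct_mulVec_le_norm (A : Mat d) (x : Fin d → ℝ) :
    x ⬝ᵥ A *ᵥ x ≤ specNorm A * (x ⬝ᵥ x) := by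
  have h1 : x ⬝ᵥ A *ᵥ x = inner ℝ (WithLp.toLp 2 x)
      (Matrix.toEuclideanCLM (𝕜 := ℝ) A (WithLp.toLp 2 x)) := by
    rw [Matrix.inner_toEuclideanCLM]
  have h2 : x ⬝ᵥ x = ‖WithLp.toLp 2 x‖ ^ 2 := by
    rw [EuclideanSpace.real_norm_sq_eq]
    simp [dotProduct, pow_two]
  rw [h1, h2, pow_two, ← mul_assoc]
  refine (real_inner_le_norm _ _).trans ?_
  rw [mul_comm]
  gcongr
  exact ContinuousLinearMap.le_opNorm _ _

lemma dotProduct_mulVec_le_frob (A : Mat d) (x : Fin d → ℝ) :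
    x ⬝ᵥ A *ᵥ x ≤ frob A * (x ⬝ᵥ x) := by
  have h1 : x ⬝ᵥ A *ᵥ x = frobInner A (vecMulVec x x) := by
    simp [frobInner, dotProduct, mulVec, vecMulVec_apply, Finset.mul_sum]
    exact Finset.sum_congr rfl fun i _ => Finset.sum_congr rfl fun j _ => by ring
  have h2 : frob (vecMulVec x x) = x ⬝ᵥ x := by
    have : frob (vecMulVec x x) ^ 2 = (x ⬝ᵥ x) ^ 2 := by
      rw [frob_sq]
      simp only [dotProduct, pow_two, vecMulVec_apply, Finset.sum_mul_sum]
      exact Finset.sum_congr rfl fun i _ => Finset.sum_congr rfl fun j _ => by ring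
    exact (sq_eq_sq₀ (frob_nonneg _) (by simpa using dotProduct_star_self_nonneg x)).1 this
  rw [h1, ← h2]
  exact frobInner_le _ _

lemma posSemidef_of_specNorm_le {A : Mat d} (hA : A.IsSymm) {c : ℝ} (h : specNorm A ≤ c) :
    (c • (1 : Mat d) - A).PosSemidef := by
  refine posSemidef_smul_one_sub hA fun x => (dotProduct_mulVec_le_norm A x).trans ?_
  have : 0 ≤ x ⬝ᵥ x := by simpa using dotProduct_star_self_nonneg x
  gcongr

lemma posSemidef_of_frob_le {A : Mat d} (hA : A.IsSymm) {c : ℝ} (h : frob A ≤ c) :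
    (c • (1 : Mat d) - A).PosSemidef := by
  refine posSemidef_smul_one_sub hA fun x => (dotProduct_mulVec_le_frob A x).trans ?_
  have : 0 ≤ x ⬝ᵥ x := by simpa using dotProduct_star_self_nonneg x
  gcongr

lemma posSemidef_smul_one_sub_mono {A : Mat d} {b c : ℝ} (h : b ≤ c)
    (hA : (b • (1 : Mat d) - A).PosSemidef) : (c • (1 : Mat d) - A).PosSemidef := by
  have : c • (1 : Mat d) - A = (b • (1 : Mat d) - A) + (c - b) • 1 := by
    rw [sub_smul]; abel
  rw [this]
  exact hA.add (PosSemidef.one.smul (sub_nonneg.2 h))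

lemma posDef_mul_inv {A : Mat d} (hA : A.PosDef) : A * A⁻¹ = 1 :=
  mul_nonsing_inv _ (isUnit_iff_ne_zero.2 hA.det_pos.ne')

lemma posDef_inv_mul {A : Mat d} (hA : A.PosDef) : A⁻¹ * A = 1 :=
  nonsing_inv_mul _ (isUnit_iff_ne_zero.2 hA.det_pos.ne')

/-- If `A ⪯ b` then `b⁻¹ ⪯ A⁻¹`. -/
lemma posSemidef_inv_sub {A : Mat d} (hA : A.PosDef) {b : ℝ} (hb : 0 < b)
    (h : (b • (1 : Mat d) - A).PosSemidef) : (A⁻¹ - b⁻¹ • (1 : Mat d)).PosSemidef := by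
  set E := b • (1 : Mat d) - A with hE
  have hAE : A = b • (1 : Mat d) - E := by simp [hE]
  have h1 : A⁻¹ * E = b • A⁻¹ - 1 := by simp [hE, mul_sub, posDef_inv_mul hA]
  have h2 : E * A⁻¹ = b • A⁻¹ - 1 := by simp [hE, sub_mul, posDef_mul_inv hA]
  -- An exact identity exhibits the difference as a sum of positive semidefinite terms; no
  -- diagonalization is needed.
  have key : A⁻¹ - b⁻¹ • (1 : Mat d) = (b⁻¹ * b⁻¹) • (E + E * A⁻¹ * E) := by
    rw [h2, sub_mul, smul_mul_assoc, h1]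
    simp only [one_mul, hE, smul_sub, smul_add, smul_smul]
    have : b⁻¹ * b⁻¹ * b = b⁻¹ := by field_simp
    rw [← mul_assoc, this, inv_mul_cancel₀ hb.ne', one_smul]
    abel
  rw [key]
  refine PosSemidef.smul (h.add (posSemidef_conj hA.inv.posSemidef (isSymm_of_posSemidef h))) ?_
  positivity

/-- `tr (D P D Q) ≥ p q ‖D‖²` when `P ⪰ p` and `Q ⪰ q`. -/
lemma le_trace_sandwich {D P Q : Mat d} (hD : D.IsSymm) {p q : ℝ} (hp : 0 ≤ p)
    (hQ : Q.PosSemidef) (hPp : (P - p • (1 : Mat d)).PosSemidef)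
    (hQq : (Q - q • (1 : Mat d)).PosSemidef) :
    p * q * frob D ^ 2 ≤ (D * P * D * Q).trace := by
  have h1 := trace_mul_nonneg (posSemidef_conj hPp hD) hQ
  have h2 := trace_mul_nonneg (posSemidef_conj PosSemidef.one hD) hQq
  have h3 : frob D ^ 2 = (D * D).trace := by rw [← frobInner_self, frobInner_eq_trace D hD]
  have h4 : (D * (P - p • (1 : Mat d)) * D * Q).trace =
      (D * P * D * Q).trace - p * (D * D * Q).trace := by
    simp [mul_sub, sub_mul]
  have h5 : (D * 1 * D * (Q - q • (1 : Mat d))).trace =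
      (D * D * Q).trace - q * (D * D).trace := by
    simp [mul_sub]
  rw [h4] at h1
  rw [h5] at h2
  rw [h3]
  nlinarith [mul_nonneg hp h2]

lemma log_det_le_trace {A : Mat d} (hA : A.PosDef) : Real.log A.det ≤ A.trace - d := by
  rw [hA.isHermitian.det_eq_prod_eigenvalues, hA.isHermitian.trace_eq_sum_eigenvalues]
  simp only [RCLike.ofReal_real_eq_id, id_eq]
  rw [Real.log_prod fun i _ => (hA.eigenvalues_pos i).ne']
  calc ∑ i, Real.log (hA.isHermitian.eigenvalues i)
      ≤ ∑ i, (hA.isHermitian.eigenvalues i - 1) :=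
        Finset.sum_le_sum fun i _ => Real.log_le_sub_one_of_pos (hA.eigenvalues_pos i)
    _ = _ := by simp

/-- Concavity of log det in tangent form at B. Factoring B⁻¹ = CᴴC and passing to C A Cᴴ moves the
tangent point to the identity, where it is log x ≤ x - 1 on eigenvalues. -/
lemma log_det_sub_le {A B : Mat d} (hA : A.PosDef) (hB : B.PosDef) :
    Real.log A.det - Real.log B.det ≤ (B⁻¹ * A).trace - d := by
  obtain ⟨C, hC⟩ := exists_conjTranspose_mul_self hB.inv.posSemidef
  have hdet : B⁻¹.det = C.det * C.det := by rw [hC]; simp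
  have hBd : B⁻¹.det ≠ 0 := hB.inv.det_pos.ne'
  have hCd : C.det ≠ 0 := fun h => hBd (by rw [hdet, h, zero_mul])
  have hCu : IsUnit C := (isUnit_iff_isUnit_det C).2 (isUnit_iff_ne_zero.2 hCd)
  have hM : (C * A * Cᴴ).PosDef := by
    refine hA.mul_mul_conjTranspose_same ?_
    exact vecMul_injective_iff_isUnit.2 hCu
  have h := log_det_le_trace hM
  have h1 : (C * A * Cᴴ).trace = (B⁻¹ * A).trace := by
    rw [hC, mul_assoc, trace_mul_comm, mul_assoc, trace_mul_comm]
  have h2 : (C * A * Cᴴ).det = A.det / B.det := by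
    have : B⁻¹.det * B.det = 1 := by rw [← det_mul, posDef_inv_mul hB, det_one]
    rw [eq_div_iff hB.det_pos.ne']
    simp only [det_mul, det_conjTranspose, star_trivial]
    calc C.det * A.det * C.det * B.det = A.det * (B⁻¹.det * B.det) := by rw [hdet]; ring
      _ = A.det := by rw [this, mul_one]
  rwa [h1, h2, Real.log_div hA.det_pos.ne' hB.det_pos.ne'] at h

lemma posSemidef_of_eigenpairs {A : Mat d} (hA : A.IsSymm)
    (h : ∀ (v : Fin d → ℝ) (θ : ℝ), v ≠ 0 → A *ᵥ v = θ • v → 0 ≤ θ) : A.PosSemidef := by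
  have hA' := isHermitian_of_isSymm hA
  rw [hA'.posSemidef_iff_eigenvalues_nonneg]
  intro i
  refine h (hA'.eigenvectorBasis i) _ ?_ (hA'.mulVec_eigenvectorBasis i)
  intro h0
  have h1 := hA'.eigenvectorBasis.orthonormal.1 i
  have : hA'.eigenvectorBasis i = 0 := by
    ext j; exact congrFun h0 j
  simp [this] at h1

lemma posSemidef_smul_add_smul_one {A : Mat d} (hA : A.IsHermitian) {α β : ℝ}
    (h : ∀ i, 0 ≤ α * hA.eigenvalues i + β) : (α • A + β • (1 : Mat d)).PosSemidef := by
  have h1 : α • A + β • (1 : Mat d) = (hA.eigenvectorUnitary : Mat d) *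
      diagonal (fun i => α * hA.eigenvalues i + β) * (hA.eigenvectorUnitary : Mat d)ᴴ := by
    have h2 : (diagonal fun i => α * hA.eigenvalues i + β) =
        α • diagonal hA.eigenvalues + β • (1 : Mat d) := by
      rw [smul_one_eq_diagonal, ← diagonal_smul, diagonal_add]
      rfl
    have h3 : (hA.eigenvectorUnitary : Mat d) * (hA.eigenvectorUnitary : Mat d)ᴴ = 1 :=
      Unitary.mul_star_self_of_mem hA.eigenvectorUnitary.2
    rw [h2, mul_add, add_mul, mul_smul_comm, mul_smul_comm, mul_one, smul_mul_assoc,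
      smul_mul_assoc, h3]
    congr 2
    simpa [Unitary.conjStarAlgAut_apply, Function.comp_def, star_eq_conjTranspose] using
      hA.spectral_theorem
  rw [h1]
  exact (PosSemidef.diagonal h).mul_mul_conjTranspose_same _

/-! ### The update of `Θ` -/

/-- `Θ` is the positive definite solution of the stationarity equation of
`Θ ↦ objective S ρ lam (Θ, Z)`. -/
structure IsThetaStep (S : Mat d) (lam : ℝ) (Z Θ : Mat d) : Prop where
  posDef : Θ.PosDef
  eq : lam • Θ - Θ⁻¹ = lam • Z - S

open scoped MatrixOrder in
-- The root R = √(Y² + 4/λ) commutes with Y, so (R - Y)/2 has inverse T = (λ/2)(R + Y), and λΘ - T =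
-- -λY. Positivity follows from Θ + T/λ = R ⪰ 0: an eigenvalue θ of Θ satisfies θ + 1/(λθ) ≥ 0.
lemma isThetaStep_thetaOfY {S Z : Mat d} {lam : ℝ} (hlam : 0 < lam) (hS : S.IsSymm)
    (hZ : Z.IsSymm) : IsThetaStep S lam Z (thetaOfY lam ((1 / lam) • S - Z)) := by
  set Y : Mat d := (1 / lam) • S - Z with hYdef
  have hY : Y.IsSymm := by simp [hYdef, IsSymm, hS.eq, hZ.eq]
  set M : Mat d := Y.transpose * Y + (4 / lam) • (1 : Mat d) with hM
  have hMpos : M.PosSemidef := by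
    refine PosSemidef.add ?_ (PosSemidef.one.smul (by positivity))
    simpa using posSemidef_conjTranspose_mul_self Y
  set R : Mat d := CFC.sqrt M with hR
  have hRpos : R.PosSemidef := Matrix.nonneg_iff_posSemidef.1 (CFC.sqrt_nonneg M)
  have hRR : R * R = M := CFC.sqrt_mul_sqrt_self M hMpos.nonneg
  have hMY : Commute M Y := by
    simp only [hM, hY.eq]
    exact ((Commute.refl Y).mul_left (Commute.refl Y)).add_left
      ((Commute.one_left Y).smul_left _)
  have hRY : R * Y = Y * R := Commute.cfcₙ_nnreal hMY _
  have hRs := isSymm_of_posSemidef hRpos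
  have hΘ : thetaOfY lam Y = (1 / 2 : ℝ) • (-Y + R) := rfl
  rw [hΘ]
  set Θ : Mat d := (1 / 2 : ℝ) • (-Y + R) with hΘdef
  set T : Mat d := (lam / 2) • (R + Y) with hT
  have hmul : Θ * T = 1 := by
    have : (-Y + R) * (R + Y) = (4 / lam) • (1 : Mat d) := by
      simp only [add_mul, mul_add, neg_mul, hRR, hRY, hM, hY.eq]
      abel
    rw [hΘdef, hT, smul_mul_smul_comm, this, smul_smul]
    have : 1 / 2 * (lam / 2) * (4 / lam) = 1 := by field_simp; norm_num
    rw [this, one_smul]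
  have hmul' : T * Θ = 1 := mul_eq_one_comm.1 hmul
  have hinv : Θ⁻¹ = T := inv_eq_right_inv hmul
  have hΘs : Θ.IsSymm := by simp [hΘdef, IsSymm, hY.eq, hRs.eq]
  have hRsum : R = Θ + (1 / lam) • T := by
    rw [hΘdef, hT, smul_smul]
    have : 1 / lam * (lam / 2) = 1 / 2 := by field_simp
    rw [this, ← smul_add]
    have : -Y + R + (R + Y) = (2 : ℝ) • R := by rw [two_smul]; abel
    rw [this, smul_smul]
    norm_num
  clear_value Θ T
  have hpsd : Θ.PosSemidef := by
    refine posSemidef_of_eigenpairs hΘs fun v θ hv hvθ => ?_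
    have h1 : v = θ • T *ᵥ v := by
      rw [← mulVec_smul, ← hvθ, mulVec_mulVec, hmul', one_mulVec]
    have hθ : θ ≠ 0 := by
      rintro rfl
      exact hv (by rw [h1, zero_smul])
    have h2 : T *ᵥ v = θ⁻¹ • v := by
      conv_rhs => rw [h1, smul_smul, inv_mul_cancel₀ hθ, one_smul]
    have h3 : 0 ≤ (θ + 1 / lam * θ⁻¹) * (v ⬝ᵥ v) := by
      have h4 := hRpos.dotProduct_mulVec_nonneg v
      have h5 : R *ᵥ v = (Θ + (1 / lam) • T) *ᵥ v := by rw [← hRsum]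
      rw [h5, add_mulVec, smul_mulVec, hvθ, h2, smul_smul, ← add_smul] at h4
      simpa using h4
    have hvv : 0 < v ⬝ᵥ v := by
      simpa using dotProduct_star_self_pos_iff.2 hv
    by_contra! hneg
    have h5 : θ⁻¹ < 0 := inv_lt_zero.2 hneg
    have h6 : 1 / lam * θ⁻¹ < 0 := mul_neg_of_pos_of_neg (by positivity) h5
    nlinarith
  refine ⟨hpsd.posDef_iff_det_ne_zero.2 fun h0 => ?_, ?_⟩
  · have := congrArg det hmul
    rw [det_mul, h0, zero_mul, det_one] at this
    exact zero_ne_one this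
  · have hYeq : lam • Z - S = -(lam • Y) := by
      rw [hYdef, smul_sub, smul_smul, mul_one_div_cancel hlam.ne', one_smul]; abel
    rw [hinv, hYeq, hΘdef, hT, smul_smul]
    have : lam * (1 / 2) = lam / 2 := by ring
    rw [this, ← smul_sub]
    have : -Y + R - (R + Y) = -((2 : ℝ) • Y) := by rw [two_smul]; abel
    rw [this, smul_neg, smul_smul, div_mul_cancel₀ _ (two_ne_zero)]

lemma IsThetaStep.contraction {S Z₁ Z₂ Θ₁ Θ₂ : Mat d} {lam B : ℝ} (hlam : 0 < lam) (hB : 0 < B)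
    (h₁ : IsThetaStep S lam Z₁ Θ₁) (h₂ : IsThetaStep S lam Z₂ Θ₂)
    (hB₁ : (B • (1 : Mat d) - Θ₁).PosSemidef) (hB₂ : (B • (1 : Mat d) - Θ₂).PosSemidef) :
    frob (Θ₁ - Θ₂) ≤ lam / (lam + B⁻¹ * B⁻¹) * frob (Z₁ - Z₂) := by
  set D := Θ₁ - Θ₂ with hD
  have hDs : D.IsSymm := by
    simp [hD, IsSymm, (isSymm_of_posDef h₁.posDef).eq, (isSymm_of_posDef h₂.posDef).eq]
  have hinv : Θ₁⁻¹ * D * Θ₂⁻¹ = Θ₂⁻¹ - Θ₁⁻¹ := by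
    rw [hD, mul_sub, sub_mul, posDef_inv_mul h₁.posDef, one_mul, mul_assoc,
      posDef_mul_inv h₂.posDef, mul_one]
  have heq : lam • D + Θ₁⁻¹ * D * Θ₂⁻¹ = lam • (Z₁ - Z₂) := by
    rw [hinv, hD, smul_sub, smul_sub]
    have := congrArg₂ (· - ·) h₁.eq h₂.eq
    calc _ = lam • Θ₁ - Θ₁⁻¹ - (lam • Θ₂ - Θ₂⁻¹) := by abel
      _ = _ := by rw [this]; abel
  have h := congrArg (fun A => frobInner A D) heq
  simp only [frobInner_add_left, frobInner_smul_left, frobInner_self] at h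
  rw [frobInner_eq_trace _ hDs, trace_mul_comm, ← mul_assoc, ← mul_assoc] at h
  have hs := le_trace_sandwich hDs (inv_nonneg.2 hB.le) h₂.posDef.inv.posSemidef
    (posSemidef_inv_sub h₁.posDef hB hB₁) (posSemidef_inv_sub h₂.posDef hB hB₂)
  have hcs := frobInner_le (Z₁ - Z₂) D
  have hpos : 0 < lam + B⁻¹ * B⁻¹ := by positivity
  rw [div_mul_eq_mul_div, le_div_iff₀ hpos]
  rcases (frob_nonneg D).eq_or_lt with h0 | h0
  · rw [← h0, zero_mul]
    exact mul_nonneg hlam.le (frob_nonneg _)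
  · refine le_of_mul_le_mul_right ?_ h0
    nlinarith [mul_le_mul_of_nonneg_left hcs hlam.le]

lemma frob_sub_sq (A B : Mat d) :
    frob (A - B) ^ 2 = frob A ^ 2 - 2 * frobInner A B + frob B ^ 2 := by
  simp only [← frobInner_self]
  rw [frobInner_sub_left, frobInner_comm A (A - B), frobInner_comm B (A - B),
    frobInner_sub_left, frobInner_sub_left, frobInner_comm B A]
  ring

/-- The log det is replaced by its tangent at Θ₀; stationarity cancels all linear terms, and the
quadratic penalty leaves exactly the gap. This gap makes a minimizer equal to its own update. -/
lemma IsThetaStep.objective_le {S Z Θ₀ Θ : Mat d} {ρ lam : ℝ}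
    (h : IsThetaStep S lam Z Θ₀) (hΘ : Θ.PosDef) :
    objective S ρ lam (Θ₀, Z) + lam / 2 * frob (Θ - Θ₀) ^ 2 ≤ objective S ρ lam (Θ, Z) := by
  have hlog := log_det_sub_le hΘ h.posDef
  have hDs : (Θ - Θ₀).IsSymm := by
    simp [IsSymm, (isSymm_of_posDef hΘ).eq, (isSymm_of_posDef h.posDef).eq]
  have hS : S = lam • (Z - Θ₀) + Θ₀⁻¹ := by
    have := h.eq
    rw [smul_sub]
    rw [sub_eq_sub_iff_add_eq_add] at this
    rw [eq_comm, sub_add_eq_add_sub, sub_eq_iff_eq_add, ← this]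
    abel
  have htr : (S * Θ).trace - (S * Θ₀).trace =
      lam * frobInner (Z - Θ₀) (Θ - Θ₀) + ((Θ₀⁻¹ * Θ).trace - d) := by
    rw [← trace_sub, ← mul_sub, ← frobInner_eq_trace S hDs]
    conv_lhs => rw [hS]
    rw [frobInner_add_left, frobInner_smul_left, frobInner_eq_trace Θ₀⁻¹ hDs, mul_sub,
      posDef_inv_mul h.posDef, trace_sub, trace_one]
    simp
  have hsq : frob (Z - Θ) ^ 2 = frob (Z - Θ₀) ^ 2 - 2 * frobInner (Z - Θ₀) (Θ - Θ₀)
      + frob (Θ - Θ₀) ^ 2 := by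
    rw [← frob_sub_sq]; congr 2; abel
  simp only [objective]
  rw [hsq]
  linarith

/-! ### Soft thresholding -/

/-- Scalar soft thresholding. -/
def shrink (t x : ℝ) : ℝ := Real.sign x * max (|x| - t) 0

lemma softThreshold_apply (t : ℝ) (A : Mat d) (i j : Fin d) :
    softThreshold t A i j = shrink t (A i j) := rfl

lemma abs_sub_shrink_le {t : ℝ} (ht : 0 ≤ t) (x : ℝ) : |x - shrink t x| ≤ t := by
  unfold shrink
  rcases lt_trichotomy x 0 with h | h | h
  · rw [Real.sign_of_neg h, abs_of_neg h, abs_le]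
    rcases max_cases (-x - t) 0 with ⟨h1, h2⟩ | ⟨h1, h2⟩ <;> rw [h1] <;> constructor <;> linarith
  · simp [h, ht]
  · rw [Real.sign_of_pos h, abs_of_pos h, abs_le]
    rcases max_cases (x - t) 0 with ⟨h1, h2⟩ | ⟨h1, h2⟩ <;> rw [h1] <;> constructor <;> linarith

/-- With `abs_sub_shrink_le`, this says that x - η is a subgradient of t|·| at η = `shrink t x`.
Nonexpansiveness and the proximal inequality follow from these two facts. -/
lemma sub_shrink_mul_shrink (t x : ℝ) :
    (x - shrink t x) * shrink t x = t * |shrink t x| := by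
  unfold shrink
  rcases lt_trichotomy x 0 with h | h | h
  · rw [Real.sign_of_neg h, abs_of_neg h]
    rcases max_cases (-x - t) 0 with ⟨h1, h2⟩ | ⟨h1, h2⟩ <;> rw [h1]
    · rw [abs_of_nonpos (by linarith)]; ring
    · simp
  · simp [h]
  · rw [Real.sign_of_pos h, abs_of_pos h]
    rcases max_cases (x - t) 0 with ⟨h1, h2⟩ | ⟨h1, h2⟩ <;> rw [h1]
    · rw [abs_of_nonneg (by linarith)]; ring
    · simp

lemma mul_le_of_abs_le {g t : ℝ} (h : |g| ≤ t) (z : ℝ) : g * z ≤ t * |z| :=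
  (le_abs_self _).trans (by rw [abs_mul]; gcongr)

lemma abs_shrink_sub_shrink_le {t : ℝ} (ht : 0 ≤ t) (x y : ℝ) :
    |shrink t x - shrink t y| ≤ |x - y| := by
  have h1 := sub_shrink_mul_shrink t x
  have h2 := sub_shrink_mul_shrink t y
  have h3 := mul_le_of_abs_le (abs_sub_shrink_le ht x) (shrink t y)
  have h4 := mul_le_of_abs_le (abs_sub_shrink_le ht y) (shrink t x)
  refine abs_le_of_sq_le_sq' ?_ (abs_nonneg _) |> abs_le.2
  rw [sq_abs]
  nlinarith [sq_nonneg ((x - shrink t x) - (y - shrink t y))]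

lemma shrink_prox {t : ℝ} (ht : 0 ≤ t) (x z : ℝ) :
    t * |shrink t x| + (shrink t x - x) ^ 2 / 2 + (z - shrink t x) ^ 2 / 2 ≤
      t * |z| + (z - x) ^ 2 / 2 := by
  have h1 := sub_shrink_mul_shrink t x
  have h3 := mul_le_of_abs_le (abs_sub_shrink_le ht x) z
  nlinarith

lemma frob_softThreshold_sub_le {t : ℝ} (ht : 0 ≤ t) (A B : Mat d) :
    frob (softThreshold t A - softThreshold t B) ≤ frob (A - B) :=
  frob_le_frob_of_abs_le fun i j => abs_shrink_sub_shrink_le ht (A i j) (B i j)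

lemma isSymm_softThreshold (t : ℝ) {A : Mat d} (hA : A.IsSymm) : (softThreshold t A).IsSymm := by
  ext i j
  simp only [transpose_apply, softThreshold_apply, hA.apply]

lemma objective_softThreshold_le {S : Mat d} {ρ lam : ℝ} (hρ : 0 ≤ ρ) (hlam : 0 < lam)
    (Θ Z : Mat d) :
    objective S ρ lam (Θ, softThreshold (ρ / lam) Θ) +
      lam / 2 * frob (Z - softThreshold (ρ / lam) Θ) ^ 2 ≤ objective S ρ lam (Θ, Z) := by
  have key : ρ * l1 (softThreshold (ρ / lam) Θ) +
      lam / 2 * frob (softThreshold (ρ / lam) Θ - Θ) ^ 2 +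
      lam / 2 * frob (Z - softThreshold (ρ / lam) Θ) ^ 2 ≤
      ρ * l1 Z + lam / 2 * frob (Z - Θ) ^ 2 := by
    simp only [frob_sq, l1, Finset.mul_sum, ← Finset.sum_add_distrib]
    refine Finset.sum_le_sum fun i _ => Finset.sum_le_sum fun j _ => ?_
    have h := mul_le_mul_of_nonneg_left
      (shrink_prox (div_nonneg hρ hlam.le) (Θ i j) (Z i j)) hlam.le
    have e : ∀ u : ℝ, lam * (ρ / lam * u) = ρ * u := fun u => by field_simp
    simp only [mul_add, e] at h
    simp only [Matrix.sub_apply, softThreshold_apply]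
    linarith
  simp only [objective]
  linarith

/-! ### Minimizers as fixed points -/

/-- `p` is fixed by a full sweep of alternating minimization. -/
structure IsFixed (S : Mat d) (ρ lam : ℝ) (p : Mat d × Mat d) : Prop where
  step : IsThetaStep S lam p.2 p.1
  soft : p.2 = softThreshold (ρ / lam) p.1

lemma IsFixed.isSymm {S : Mat d} {ρ lam : ℝ} {p : Mat d × Mat d} (h : IsFixed S ρ lam p) :
    p.2.IsSymm := by
  rw [h.soft]
  exact isSymm_softThreshold _ (isSymm_of_posDef h.step.posDef)

lemma eq_of_frob_sq_nonpos {A B : Mat d} {lam : ℝ} (hlam : 0 < lam)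
    (h : lam / 2 * frob (A - B) ^ 2 ≤ 0) : A = B := by
  have h1 : frob (A - B) ^ 2 ≤ 0 := by
    by_contra! h2
    have : 0 < lam / 2 * frob (A - B) ^ 2 := by positivity
    linarith
  exact sub_eq_zero.1 (frob_eq_zero (pow_eq_zero_iff two_ne_zero |>.1 (h1.antisymm (sq_nonneg _))))

/-- The domain `D` is left open because both `sym d` and `spd d` are needed. -/
lemma IsPenaltyMin.isThetaStep {S : Mat d} {ρ lam : ℝ} {D : Set (Mat d)} {p : Mat d × Mat d}
    (hlam : 0 < lam) (hS : S.IsSymm) (hD : D ⊆ sym d) (h : IsPenaltyMin S ρ lam D p) :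
    IsThetaStep S lam p.2 p.1 := by
  obtain ⟨⟨hp1, hp2⟩, hmin⟩ := h
  have hstep := isThetaStep_thetaOfY hlam hS (hD hp2)
  have h1 := hstep.objective_le (ρ := ρ) hp1
  have h2 : objective S ρ lam p ≤ objective S ρ lam (_, p.2) :=
    hmin (Set.mk_mem_prod hstep.posDef hp2)
  have := eq_of_frob_sq_nonpos (A := p.1)
    (B := thetaOfY lam ((1 / lam) • S - p.2)) hlam (by linarith)
  rwa [← this] at hstep

lemma IsPenaltyMin.isFixed {S : Mat d} {ρ lam : ℝ} {p : Mat d × Mat d}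
    (hρ : 0 ≤ ρ) (hlam : 0 < lam) (hS : S.IsSymm) (h : IsPenaltyMin S ρ lam (sym d) p) :
    IsFixed S ρ lam p := by
  refine ⟨h.isThetaStep hlam hS subset_rfl, ?_⟩
  obtain ⟨⟨hp1, hp2⟩, hmin⟩ := h
  have h1 := objective_softThreshold_le (S := S) hρ hlam p.1 p.2
  have h2 : objective S ρ lam p ≤ objective S ρ lam (p.1, softThreshold (ρ / lam) p.1) :=
    hmin (Set.mk_mem_prod hp1 (isSymm_softThreshold _ (isSymm_of_posDef hp1)))
  exact eq_of_frob_sq_nonpos hlam (by linarith)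

lemma posSemidef_frob_add (A B : Mat d) (hA : A.IsSymm) :
    ((frob A + frob B + 1) • (1 : Mat d) - A).PosSemidef :=
  posSemidef_of_frob_le hA (by linarith [frob_nonneg B])

lemma IsFixed.unique {S : Mat d} {ρ lam : ℝ} {p q : Mat d × Mat d} (hρ : 0 ≤ ρ) (hlam : 0 < lam)
    (hp : IsFixed S ρ lam p) (hq : IsFixed S ρ lam q) : p = q := by
  set B := frob p.1 + frob q.1 + 1 with hB
  have hB0 : 0 < B := by have := frob_nonneg p.1; have := frob_nonneg q.1; linarith
  have h1 := hp.step.contraction hlam hB0 hq.step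
    (posSemidef_frob_add _ _ (isSymm_of_posDef hp.step.posDef))
    (by simpa [hB, add_comm] using posSemidef_frob_add q.1 p.1 (isSymm_of_posDef hq.step.posDef))
  have h2 := frob_softThreshold_sub_le (div_nonneg hρ hlam.le) p.1 q.1
  rw [← hp.soft, ← hq.soft] at h2
  have hC : lam / (lam + B⁻¹ * B⁻¹) < 1 := by
    rw [div_lt_one (by positivity)]
    have : 0 < B⁻¹ * B⁻¹ := by positivity
    linarith
  have hC0 : 0 ≤ lam / (lam + B⁻¹ * B⁻¹) := by positivity
  have h3 : frob (p.1 - q.1) = 0 := by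
    have := mul_le_mul_of_nonneg_left h2 hC0
    nlinarith [frob_nonneg (p.1 - q.1)]
  have h4 : frob (p.2 - q.2) = 0 := le_antisymm (h2.trans h3.le) (frob_nonneg _)
  exact Prod.ext (sub_eq_zero.1 (frob_eq_zero h3)) (sub_eq_zero.1 (frob_eq_zero h4))

/-! ### Existence of the minimizer -/

lemma l1_nonneg (A : Mat d) : 0 ≤ l1 A := by unfold l1; positivity

lemma trace_le_l1 (A : Mat d) : A.trace ≤ l1 A :=
  Finset.sum_le_sum fun i _ => (le_abs_self _).trans
    (Finset.single_le_sum (f := fun j => |A i j|) (fun _ _ => abs_nonneg _) (Finset.mem_univ i))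

lemma trace_le_frob (A : Mat d) : A.trace ≤ d * frob A := by
  calc A.trace ≤ ∑ _i : Fin d, frob A :=
        Finset.sum_le_sum fun i _ => (le_abs_self _).trans (abs_le_frob A i i)
    _ = d * frob A := by simp

/-- The log det is at most (ρ/2) tr Θ plus a constant, and tr Θ ≤ ‖Z‖₁ + d‖Z - Θ‖. Half of the ℓ₁
term and half of the quadratic term pay for this; the other halves bound Z and Z - Θ. Only tr(SΘ) ≥
0 is used of S, so B serves all S. -/
lemma exists_coercivity_bound (d : ℕ) {ρ lam : ℝ} (hρ : 0 < ρ) (hlam : 0 < lam) (K : ℝ) :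
    ∃ B : ℝ, 0 < B ∧ ∀ S Θ Z : Mat d, S.PosSemidef → Θ.PosDef →
      objective S ρ lam (Θ, Z) ≤ K → frob Θ ≤ B ∧ frob Z ≤ B := by
  set K' : ℝ := K - (d * Real.log (ρ / 2) + d) + (ρ / 2 * d) ^ 2 / lam with hK'
  -- The two terms bound ‖Z‖₁ and t² with t = ‖Z - Θ‖; the 1 comes from t ≤ t² + 1.
  refine ⟨|K'| * (2 / ρ + 4 / lam) + 1, by positivity, fun S Θ Z hS hΘ hobj => ?_⟩
  have hlog : d * Real.log (ρ / 2) + Real.log Θ.det ≤ ρ / 2 * Θ.trace - d := by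
    have h := log_det_le_trace (hΘ.smul (half_pos hρ))
    rw [det_smul, trace_smul, Fintype.card_fin,
      Real.log_mul (by positivity) hΘ.det_pos.ne', Real.log_pow] at h
    exact h
  have htr := trace_mul_nonneg hS hΘ.posSemidef
  have h1 : Θ.trace ≤ l1 Z + d * frob (Z - Θ) := by
    have h2 := trace_le_l1 Z
    have h3 := trace_le_frob (Θ - Z)
    rw [trace_sub, frob_sub_comm] at h3
    linarith
  set t := frob (Z - Θ) with ht
  have ht0 : 0 ≤ t := frob_nonneg _
  have hsq : ρ / 2 * d * t ≤ lam / 4 * t ^ 2 + (ρ / 2 * d) ^ 2 / lam := by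
    have : lam / 4 * t ^ 2 + (ρ / 2 * d) ^ 2 / lam - ρ / 2 * d * t =
        (lam * t / 2 - ρ / 2 * d) ^ 2 / lam := by field_simp; ring
    have : 0 ≤ (lam * t / 2 - ρ / 2 * d) ^ 2 / lam := by positivity
    linarith
  have hmain : ρ / 2 * l1 Z + lam / 4 * t ^ 2 ≤ K' := by
    simp only [objective] at hobj
    have := mul_le_mul_of_nonneg_left h1 (half_pos hρ).le
    rw [hK']
    linarith
  have hK0 := le_abs_self K'
  have hl := l1_nonneg Z
  have hZ : l1 Z ≤ |K'| * (2 / ρ) := by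
    rw [mul_div_assoc', le_div_iff₀ hρ]
    nlinarith [mul_nonneg hlam.le (sq_nonneg t)]
  have hT : t ^ 2 ≤ |K'| * (4 / lam) := by
    rw [mul_div_assoc', le_div_iff₀ hlam]
    nlinarith [mul_nonneg hρ.le hl]
  have hfZ := frob_le_l1 Z
  have hfΘ : frob Θ ≤ t + frob Z := by
    have := frob_add_le (Θ - Z) Z
    rw [sub_add_cancel, frob_sub_comm] at this
    exact this
  rw [mul_add]
  constructor <;> nlinarith [sq_nonneg (t - 1), sq_nonneg t]

lemma isClosed_posSemidef : IsClosed {A : Mat d | A.PosSemidef} := by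
  have : {A : Mat d | A.PosSemidef} =
      {A | Aᴴ = A} ∩ ⋂ x : Fin d → ℝ, {A | 0 ≤ star x ⬝ᵥ A *ᵥ x} := by
    ext A
    simp only [Set.mem_ofPred_eq, Set.mem_inter_iff, Set.mem_iInter]
    exact ⟨fun h => ⟨h.isHermitian, h.dotProduct_mulVec_nonneg⟩,
      fun h => PosSemidef.of_dotProduct_mulVec_nonneg h.1 h.2⟩
  rw [this]
  refine IsClosed.inter (isClosed_eq (by fun_prop) continuous_id) (isClosed_iInter fun x => ?_)
  exact isClosed_le continuous_const (by fun_prop)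

lemma isCompact_entries_bounded (d : ℕ) (B : ℝ) :
    IsCompact {A : Mat d | ∀ i j, A i j ∈ Set.Icc (-B) B} := by
  have : IsCompact (Set.pi Set.univ fun _ : Fin d =>
      Set.pi Set.univ fun _ : Fin d => Set.Icc (-B) B) :=
    isCompact_univ_pi fun _ => isCompact_univ_pi fun _ => isCompact_Icc
  have e : {A : Mat d | ∀ i j, A i j ∈ Set.Icc (-B) B} = (Set.pi Set.univ fun _ : Fin d =>
      Set.pi Set.univ fun _ : Fin d => Set.Icc (-B) B) := by
    ext A
    exact ⟨fun h i _ j _ => h i j, fun h i j => h i trivial j trivial⟩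
  rw [e]
  exact this

lemma objective_one_zero (S : Mat d) (ρ lam : ℝ) :
    objective S ρ lam (1, 0) = S.trace + lam / 2 * d := by
  have : frob ((0 : Mat d) - 1) ^ 2 = d := by
    rw [frob_sub_comm, sub_zero, frob_sq]
    simp [Matrix.one_apply, ite_pow]
  simp only [objective, this]
  simp [l1]

lemma exists_isPenaltyMin {S : Mat d} (hS : S.PosSemidef) {ρ lam : ℝ} (hρ : 0 < ρ)
    (hlam : 0 < lam) : ∃ p, IsPenaltyMin S ρ lam (sym d) p := by
  set K := objective S ρ lam (1, 0) with hK
  obtain ⟨B, hB0, hB⟩ := exists_coercivity_bound d hρ hlam K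
  set E : Set (Mat d) := {A | ∀ i j, A i j ∈ Set.Icc (-B) B} with hE
  -- On the sublevel set all terms other than -log det are nonnegative, so det Θ ≥ exp(-K). This
  -- closed condition keeps limits positive definite and the logarithm continuous.
  set F : Set (Mat d × Mat d) := {p | p.1.PosSemidef ∧ p.2.IsSymm ∧ Real.exp (-K) ≤ p.1.det}
  have hEc : IsCompact E := isCompact_entries_bounded d B
  have hF : IsClosed F := by
    refine (isClosed_posSemidef.preimage continuous_fst).inter (IsClosed.inter ?_ ?_)
    · exact isClosed_eq (f := fun p : Mat d × Mat d => p.2ᵀ) (g := fun p => p.2)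
        (by fun_prop) (by fun_prop)
    · exact isClosed_le (g := fun p : Mat d × Mat d => p.1.det) continuous_const (by fun_prop)
  have hc : IsCompact ((E ×ˢ E) ∩ F) := (hEc.prod hEc).inter_right hF
  have hmem : ∀ q ∈ spd d ×ˢ sym d, objective S ρ lam q ≤ K → q ∈ (E ×ˢ E) ∩ F := by
    rintro ⟨Θ, Z⟩ ⟨hΘ, hZ⟩ hq
    have hΘ' : Θ.PosDef := hΘ
    obtain ⟨h1, h2⟩ := hB S Θ Z hS hΘ hq
    refine ⟨⟨fun i j => abs_le.1 ((abs_le_frob Θ i j).trans h1),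
      fun i j => abs_le.1 ((abs_le_frob Z i j).trans h2)⟩, hΘ'.posSemidef, hZ, ?_⟩
    rw [← Real.le_log_iff_exp_le hΘ'.det_pos]
    have h3 := trace_mul_nonneg hS hΘ'.posSemidef
    have h4 := mul_nonneg hρ.le (l1_nonneg Z)
    have h5 : 0 ≤ lam / 2 * frob (Z - Θ) ^ 2 := by positivity
    simp only [objective] at hq
    linarith
  have h10 : ((1 : Mat d), (0 : Mat d)) ∈ spd d ×ˢ sym d :=
    ⟨(PosDef.one : (1 : Mat d).PosDef), (by simp [IsSymm] : (0 : Mat d).IsSymm)⟩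
  have hcont : ContinuousOn (objective S ρ lam) ((E ×ˢ E) ∩ F) := by
    have hl : ContinuousOn (fun p : Mat d × Mat d => Real.log p.1.det) ((E ×ˢ E) ∩ F) :=
      ContinuousOn.log (by fun_prop) fun p hp => ((Real.exp_pos _).trans_le hp.2.2.2).ne'
    unfold objective frob l1
    refine ContinuousOn.add (ContinuousOn.add (ContinuousOn.add hl.neg ?_) ?_) ?_
    · exact Continuous.continuousOn (by fun_prop)
    · exact Continuous.continuousOn (by fun_prop)
    · refine Continuous.continuousOn (continuous_const.mul (Continuous.pow ?_ 2))
      refine Real.continuous_sqrt.comp ?_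
      simp only [Matrix.sub_apply]
      fun_prop
  obtain ⟨p, hp, hmin⟩ := hc.exists_isMinOn ⟨_, hmem _ h10 le_rfl⟩ hcont
  refine ⟨p, ⟨?_, hp.2.2.1⟩, fun q hq => ?_⟩
  · exact hp.2.1.posDef_iff_det_ne_zero.2 ((Real.exp_pos _).trans_le hp.2.2.2).ne'
  · by_cases h : objective S ρ lam q ≤ K
    · exact hmin (hmem q hq h)
    · exact (hmin (hmem _ h10 le_rfl) : _ ≤ _).trans (le_of_not_ge h)

/-- A minimizer exists and is fixed, and fixed points are unique; so a fixed point is the minimizer,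
without appeal to joint convexity. -/
lemma isFixed_iff_isPenaltyMin {S : Mat d} (hS : S.PosSemidef) {ρ lam : ℝ} (hρ : 0 < ρ)
    (hlam : 0 < lam) {p : Mat d × Mat d} : IsFixed S ρ lam p ↔ IsPenaltyMin S ρ lam (sym d) p := by
  refine ⟨fun h => ?_, fun h => h.isFixed hρ.le hlam (isSymm_of_posSemidef hS)⟩
  obtain ⟨q, hq⟩ := exists_isPenaltyMin hS hρ hlam
  rwa [h.unique hρ.le hlam (hq.isFixed hρ.le hlam (isSymm_of_posSemidef hS))]

lemma objective_segment_le {S Θ Z Z' : Mat d} {ρ lam t : ℝ} (hρ : 0 ≤ ρ) (hlam : 0 ≤ lam)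
    (ht0 : 0 ≤ t) (ht1 : t ≤ 1) :
    objective S ρ lam (Θ, Z + t • (Z' - Z)) ≤
      (1 - t) * objective S ρ lam (Θ, Z) + t * objective S ρ lam (Θ, Z') := by
  have key : ρ * l1 (Z + t • (Z' - Z)) + lam / 2 * frob (Z + t • (Z' - Z) - Θ) ^ 2 ≤
      (1 - t) * (ρ * l1 Z + lam / 2 * frob (Z - Θ) ^ 2) +
        t * (ρ * l1 Z' + lam / 2 * frob (Z' - Θ) ^ 2) := by
    simp only [frob_sq, l1, Finset.mul_sum, ← Finset.sum_add_distrib]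
    refine Finset.sum_le_sum fun i _ => Finset.sum_le_sum fun j _ => ?_
    simp only [Matrix.sub_apply, Matrix.add_apply, Matrix.smul_apply, smul_eq_mul]
    generalize Z i j = x, Z' i j = y, Θ i j = z
    have h1 : |x + t * (y - x)| ≤ (1 - t) * |x| + t * |y| := by
      calc |x + t * (y - x)| = |(1 - t) * x + t * y| := by ring_nf
        _ ≤ |(1 - t) * x| + |t * y| := abs_add_le _ _
        _ = _ := by rw [abs_mul, abs_mul, abs_of_nonneg ht0, abs_of_nonneg (sub_nonneg.2 ht1)]
    have h2 : (x + t * (y - x) - z) ^ 2 ≤ (1 - t) * (x - z) ^ 2 + t * (y - z) ^ 2 := by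
      nlinarith [mul_nonneg (mul_nonneg ht0 (sub_nonneg.2 ht1)) (sq_nonneg (x - y))]
    have := mul_le_mul_of_nonneg_left h1 hρ
    have := mul_le_mul_of_nonneg_left h2 (div_nonneg hlam zero_le_two)
    linarith
  simp only [objective]
  linarith

lemma exists_pos_posSemidef_sub {A : Mat d} (hA : A.PosDef) :
    ∃ μ : ℝ, 0 < μ ∧ (A - μ • (1 : Mat d)).PosSemidef := by
  have hb : 0 < frob A⁻¹ + 1 := by linarith [frob_nonneg A⁻¹]
  refine ⟨(frob A⁻¹ + 1)⁻¹, inv_pos.2 hb, ?_⟩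
  have h := posSemidef_inv_sub hA.inv hb
    (posSemidef_of_frob_le (isSymm_of_posDef hA.inv) (by linarith))
  rwa [nonsing_inv_nonsing_inv _ (isUnit_iff_ne_zero.2 hA.det_pos.ne')] at h

lemma exists_segment_posDef {A E : Mat d} (hA : A.PosDef) (hE : E.IsSymm) :
    ∃ t : ℝ, 0 < t ∧ t ≤ 1 ∧ (A + t • E).PosDef := by
  obtain ⟨μ, hμ, hAμ⟩ := exists_pos_posSemidef_sub hA
  have hf := frob_nonneg E
  have hden : 0 < frob E + μ + 1 := by linarith
  have ht : 0 < μ / (frob E + μ + 1) := by positivity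
  refine ⟨μ / (frob E + μ + 1), ht, (div_le_one hden).2 (by linarith), ?_⟩
  set t := μ / (frob E + μ + 1) with htdef
  have htf : t * frob E < μ := by
    rw [htdef, div_mul_eq_mul_div, div_lt_iff₀ hden]
    nlinarith
  have hnE : (frob E • (1 : Mat d) - -E).PosSemidef :=
    posSemidef_of_frob_le (by simp [IsSymm, hE.eq])
      (by have := frob_sub_comm 0 E; simp only [zero_sub, sub_zero] at this; exact this.le)
  have : A + t • E = (μ - t * frob E) • (1 : Mat d) +
      ((A - μ • (1 : Mat d)) + t • (frob E • (1 : Mat d) - -E)) := by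
    simp only [sub_smul, smul_sub, smul_neg, mul_smul]
    abel
  rw [this]
  exact (PosDef.one.smul (sub_pos.2 htf)).add_posSemidef (hAμ.add (hnE.smul ht.le))

/-- The thresholded matrix may fail to be positive definite, so it is not a competitor itself. But a
short segment from `p.2` towards it stays in the open cone, and convexity in Z carries minimality
from there to its far end. -/
lemma IsPenaltyMin.isFixed_of_spd {S : Mat d} {ρ lam : ℝ} {p : Mat d × Mat d}
    (hρ : 0 ≤ ρ) (hlam : 0 < lam) (hS : S.IsSymm) (h : IsPenaltyMin S ρ lam (spd d) p) :
    IsFixed S ρ lam p := by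
  refine ⟨h.isThetaStep hlam hS fun A hA => isSymm_of_posDef hA, ?_⟩
  obtain ⟨⟨hp1, hp2⟩, hmin⟩ := h
  set Z' := softThreshold (ρ / lam) p.1 with hZ'
  have hZs : Z'.IsSymm := isSymm_softThreshold _ (isSymm_of_posDef hp1)
  have hE : (Z' - p.2).IsSymm := by simp [IsSymm, hZs.eq, (isSymm_of_posDef hp2).eq]
  obtain ⟨t, ht0, ht1, ht⟩ := exists_segment_posDef hp2 hE
  have h1 : objective S ρ lam p ≤ objective S ρ lam (p.1, p.2 + t • (Z' - p.2)) :=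
    hmin (Set.mk_mem_prod hp1 ht)
  have h2 := objective_segment_le (S := S) (Θ := p.1) (Z := p.2) (Z' := Z') hρ hlam.le ht0.le ht1
  have h3 : objective S ρ lam (p.1, p.2) ≤ objective S ρ lam (p.1, Z') := by
    have : objective S ρ lam p = objective S ρ lam (p.1, p.2) := rfl
    refine le_of_mul_le_mul_left ?_ ht0
    linarith
  have h4 := objective_softThreshold_le (S := S) hρ hlam p.1 p.2
  exact eq_of_frob_sq_nonpos hlam (by linarith)

/-! ### Linear convergence -/

lemma contraction_factor_pos {lam B : ℝ} (hlam : 0 < lam) :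
    0 < lam / (lam + B⁻¹ * B⁻¹) :=
  div_pos hlam (add_pos_of_pos_of_nonneg hlam (mul_self_nonneg _))

lemma contraction_factor_lt_one {lam B : ℝ} (hlam : 0 < lam) (hB : 0 < B) :
    lam / (lam + B⁻¹ * B⁻¹) < 1 := by
  rw [div_lt_one (by positivity)]
  have : 0 < B⁻¹ * B⁻¹ := by positivity
  linarith

lemma IsThetaStep.frob_sub_le {S Z₁ Z₂ Θ₁ Θ₂ : Mat d} {lam : ℝ} (hlam : 0 < lam)
    (h₁ : IsThetaStep S lam Z₁ Θ₁) (h₂ : IsThetaStep S lam Z₂ Θ₂) :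
    frob (Θ₁ - Θ₂) ≤ frob (Z₁ - Z₂) := by
  have h1 := frob_nonneg Θ₁
  have h2 := frob_nonneg Θ₂
  have hB : 0 < frob Θ₁ + frob Θ₂ + 1 := by linarith
  refine (h₁.contraction hlam hB h₂
    (posSemidef_of_frob_le (isSymm_of_posDef h₁.posDef) (by linarith))
    (posSemidef_of_frob_le (isSymm_of_posDef h₂.posDef) (by linarith))).trans ?_
  exact mul_le_of_le_one_left (frob_nonneg _) (contraction_factor_lt_one hlam hB).le

lemma IsAM.isSymm {S : Mat d} {ρ lam : ℝ} {Θ Z : ℕ → Mat d} (h : IsAM S ρ lam Θ Z)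
    (hlam : 0 < lam) (hS : S.IsSymm) (hZ : (Z 0).IsSymm) (k : ℕ) : (Z k).IsSymm := by
  induction k with
  | zero => exact hZ
  | succ k ih =>
    rw [(h k).2, (h k).1]
    exact isSymm_softThreshold _ (isSymm_of_posDef (isThetaStep_thetaOfY hlam hS ih).posDef)

lemma IsAM.isThetaStep {S : Mat d} {ρ lam : ℝ} {Θ Z : ℕ → Mat d} (h : IsAM S ρ lam Θ Z)
    (hlam : 0 < lam) (hS : S.IsSymm) (hZ : (Z 0).IsSymm) (k : ℕ) :
    IsThetaStep S lam (Z k) (Θ (k + 1)) := by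
  rw [(h k).1]
  exact isThetaStep_thetaOfY hlam hS (h.isSymm hlam hS hZ k)

lemma frob_le_of_specNorm_le {A : Mat d} {c : ℝ} (h : specNorm A ≤ c) : frob A ≤ d * c := by
  refine frob_le_of_abs_le ((norm_nonneg _).trans h) fun i j => ?_
  set e : EuclideanSpace ℝ (Fin d) := EuclideanSpace.single j 1 with he
  have h1 : (Matrix.toEuclideanCLM (𝕜 := ℝ) A e) i = A i j := by
    simp [he]
  have h2 := PiLp.norm_apply_le (Matrix.toEuclideanCLM (𝕜 := ℝ) A e) i
  rw [h1] at h2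
  refine h2.trans ((ContinuousLinearMap.le_opNorm _ _).trans ?_)
  simpa [he, specNorm] using h

lemma linear_convergence (c z₀ : ℝ) (hz₀ : 0 ≤ z₀) (d : ℕ) {ρ lam : ℝ} (hρ : 0 < ρ)
    (hlam : 0 < lam) :
    ∃ C : ℝ, 0 < C ∧ C < 1 ∧
      ∀ S : Mat d, S.PosSemidef → specNorm S ≤ c →
        ∀ p, IsPenaltyMin S ρ lam (sym d) p →
          ∀ Θ Z : ℕ → Mat d, IsAM S ρ lam Θ Z → Z 0 ∈ sym d → specNorm (Z 0) ≤ z₀ →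
            ∀ k, frob (Z (k + 1) - p.2) ≤ frob (Θ (k + 1) - p.1) ∧
              frob (Θ (k + 1) - p.1) ≤ C * frob (Z k - p.2) := by
  -- The level bounds the objective at (1, 0) for every admissible S.
  obtain ⟨B, hB0, hB⟩ := exists_coercivity_bound d hρ hlam (d * c + lam / 2 * d)
  -- Nonexpansiveness keeps ‖Z k - p.2‖ ≤ B + d z₀ for all k, and ‖p.1‖ ≤ B adds the second B.
  set B' := 2 * B + d * z₀ with hB'
  have hB'0 : 0 < B' := by positivity
  refine ⟨lam / (lam + B'⁻¹ * B'⁻¹), contraction_factor_pos hlam,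
    contraction_factor_lt_one hlam hB'0, fun S hS hSc p hp Θ Z hAM hZs hZ0 => ?_⟩
  have hSs := isSymm_of_posSemidef hS
  have hfix := hp.isFixed hρ.le hlam hSs
  have hpB : frob p.1 ≤ B ∧ frob p.2 ≤ B := by
    refine hB S p.1 p.2 hS hfix.step.posDef ?_
    have h1 : objective S ρ lam p ≤ objective S ρ lam (1, 0) :=
      hp.2 ⟨(PosDef.one : (1 : Mat d).PosDef), (by simp [IsSymm] : (0 : Mat d).IsSymm)⟩
    rw [objective_one_zero] at h1
    have h2 := (posSemidef_of_specNorm_le hSs hSc).trace_nonneg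
    simp only [trace_sub, trace_smul, trace_one, Fintype.card_fin, smul_eq_mul] at h2
    refine h1.trans ?_
    linarith
  have hsoft : ∀ k, frob (Z (k + 1) - p.2) ≤ frob (Θ (k + 1) - p.1) := fun k => by
    rw [(hAM k).2, hfix.soft]
    exact frob_softThreshold_sub_le (by positivity) _ _
  have hstep := hAM.isThetaStep hlam hSs hZs
  have hZk : ∀ k, frob (Z k - p.2) ≤ B + d * z₀ := by
    intro k
    induction k with
    | zero =>
      have h1 := frob_sub_le (Z 0) 0 p.2
      rw [sub_zero, frob_sub_comm 0, sub_zero] at h1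
      linarith [frob_le_of_specNorm_le hZ0]
    | succ k ih => exact (hsoft k).trans (((hstep k).frob_sub_le hlam hfix.step).trans ih)
  refine fun k => ⟨hsoft k, (hstep k).contraction hlam hB'0 hfix.step ?_ ?_⟩
  · refine posSemidef_of_frob_le (isSymm_of_posDef (hstep k).posDef) ?_
    have h1 := frob_add_le (Θ (k + 1) - p.1) p.1
    rw [sub_add_cancel] at h1
    have h2 := ((hstep k).frob_sub_le hlam hfix.step).trans (hZk k)
    linarith
  · exact posSemidef_of_frob_le (isSymm_of_posDef hfix.step.posDef)
      (by nlinarith [mul_nonneg (Nat.cast_nonneg (α := ℝ) d) hz₀])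

/-! ### Deterministic recovery bounds -/

/-- If `ε ⪯ A` then `A⁻¹ ⪯ ε⁻¹`. -/
lemma posSemidef_sub_inv {A : Mat d} (hA : A.PosDef) {ε : ℝ} (hε : 0 < ε)
    (h : (A - ε • (1 : Mat d)).PosSemidef) : (ε⁻¹ • (1 : Mat d) - A⁻¹).PosSemidef := by
  set E := A - ε • (1 : Mat d) with hE
  set X := (1 : Mat d) - ε • A⁻¹ with hX
  have h1 : A⁻¹ * E = X := by simp [hE, hX, mul_sub, posDef_inv_mul hA]
  have hXs : X.IsSymm := by simp [hX, IsSymm, transpose_sub, transpose_smul,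
    (isSymm_of_posDef hA.inv).eq]
  have key : ε⁻¹ • (1 : Mat d) - A⁻¹ = ε⁻¹ • (X * 1 * X + ε • (A⁻¹ * E * A⁻¹)) := by
    have h2 : X * 1 * X + ε • (A⁻¹ * E * A⁻¹) = X := by
      rw [h1, mul_one, ← mul_smul_comm, ← mul_add]
      simp [hX]
    rw [h2, hX, smul_sub, smul_smul, inv_mul_cancel₀ hε.ne', one_smul]
  rw [key]
  exact ((posSemidef_conj PosSemidef.one hXs).add
    ((posSemidef_conj h (isSymm_of_posDef hA.inv)).smul hε.le)).smul (inv_nonneg.2 hε.le)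

/-- For D = Θ - S₀⁻¹ one has Θ⁻¹ D S₀ = S₀ - Θ⁻¹, which stationarity turns into minus noise minus
residual. Pairing with D, the left side is bounded below through Θ ⪯ ε⁻¹ + ‖D‖; no Taylor expansion
of log det enters. -/
lemma IsFixed.basic_inequality {S S₀ : Mat d} {ρ lam ε : ℝ} {p : Mat d × Mat d}
    (hp : IsFixed S ρ lam p) (hS₀ : S₀.PosDef) (hε : 0 < ε)
    (hS₀ε : (S₀ - ε • (1 : Mat d)).PosSemidef) :
    (ε⁻¹ + frob (p.1 - S₀⁻¹))⁻¹ * ε * frob (p.1 - S₀⁻¹) ^ 2 ≤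
      -frobInner (S - S₀) (p.1 - S₀⁻¹) - frobInner (lam • (p.1 - p.2)) (p.1 - S₀⁻¹) := by
  set D := p.1 - S₀⁻¹ with hD
  have hΘ := hp.step.posDef
  have hDs : D.IsSymm := by
    simp [hD, IsSymm, (isSymm_of_posDef hΘ).eq, (isSymm_of_posDef hS₀.inv).eq]
  have hx := frob_nonneg D
  have hb : 0 < ε⁻¹ + frob D := by positivity
  have hup : ((ε⁻¹ + frob D) • (1 : Mat d) - p.1).PosSemidef := by
    have : (ε⁻¹ + frob D) • (1 : Mat d) - p.1 =
        (ε⁻¹ • (1 : Mat d) - S₀⁻¹) + (frob D • (1 : Mat d) - D) := by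
      rw [hD, add_smul]; abel
    rw [this]
    exact (posSemidef_sub_inv hS₀ hε hS₀ε).add (posSemidef_of_frob_le hDs le_rfl)
  have hs := le_trace_sandwich hDs (inv_nonneg.2 hb.le) hS₀.posSemidef
    (posSemidef_inv_sub hΘ hb hup) hS₀ε
  refine hs.trans (le_of_eq ?_)
  have h1 : p.1⁻¹ * D * S₀ = -((S - S₀) + lam • (p.1 - p.2)) := by
    have h2 : p.1⁻¹ * D * S₀ = S₀ - p.1⁻¹ := by
      rw [hD, mul_sub, sub_mul, posDef_inv_mul hΘ, one_mul, mul_assoc, posDef_inv_mul hS₀, mul_one]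
    have h3 : p.1⁻¹ = lam • p.1 - (lam • p.2 - S) := by rw [← hp.step.eq]; abel
    rw [h2, smul_sub, h3]
    abel
  have h4 : (D * p.1⁻¹ * D * S₀).trace = frobInner (p.1⁻¹ * D * S₀) D := by
    rw [frobInner_eq_trace _ hDs, trace_mul_comm _ D]
    simp only [mul_assoc]
  rw [h4, h1, frobInner_neg_left, frobInner_add_left]
  ring

lemma IsFixed.abs_residual_le {S : Mat d} {ρ lam : ℝ} {p : Mat d × Mat d} (hρ : 0 ≤ ρ)
    (hlam : 0 < lam) (hp : IsFixed S ρ lam p) (i j : Fin d) :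
    |(lam • (p.1 - p.2)) i j| ≤ ρ := by
  have h := abs_sub_shrink_le (div_nonneg hρ hlam.le) (p.1 i j)
  rw [hp.soft]
  simp only [Matrix.smul_apply, Matrix.sub_apply, softThreshold_apply, smul_eq_mul]
  rw [abs_mul, abs_of_pos hlam]
  calc lam * |p.1 i j - shrink (ρ / lam) (p.1 i j)| ≤ lam * (ρ / lam) := by gcongr
    _ = ρ := by field_simp

lemma neg_frobInner_le {A D : Mat d} {t : ℝ} (ht : 0 ≤ t) (h : ∀ i j, |A i j| ≤ t) :
    -frobInner A D ≤ d * t * frob D := by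
  rw [← frobInner_neg_left]
  refine (frobInner_le _ _).trans ?_
  gcongr
  · exact frob_nonneg _
  · exact frob_le_of_abs_le ht fun i j => by simpa using h i j

/-- The left side equals ε²x²/(1 + εx), quadratic near 0 but only linear at infinity. Smallness of β
+ γ excludes x > 1, and on [0, 1] the denominator is at most 1 + ε. -/
lemma self_bounding {ε x β γ : ℝ} (hε : 0 < ε) (hx : 0 ≤ x) (hγ : 0 ≤ γ)
    (hsmall : β + γ < ε ^ 2 / (1 + ε)) (h : (ε⁻¹ + x)⁻¹ * ε * x ^ 2 ≤ β * x + γ) :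
    x ≤ 1 ∧ ε ^ 2 / (1 + ε) * x ^ 2 ≤ β * x + γ := by
  have e1 : (ε⁻¹ + x)⁻¹ * ε * x ^ 2 = ε ^ 2 * x ^ 2 / (1 + ε * x) := by field_simp
  rw [e1] at h
  have hx1 : x ≤ 1 := by
    by_contra! hx1
    have h1 : ε ^ 2 / (1 + ε) * x ≤ ε ^ 2 * x ^ 2 / (1 + ε * x) := by
      rw [div_mul_eq_mul_div, div_le_div_iff₀ (by positivity) (by positivity)]
      have : 0 ≤ ε ^ 2 * x * (x - 1) :=
        mul_nonneg (by positivity) (by linarith)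
      nlinarith
    nlinarith
  refine ⟨hx1, le_trans ?_ h⟩
  rw [div_mul_eq_mul_div]
  gcongr
  nlinarith

lemma IsFixed.frob_sub_le_dense {S S₀ : Mat d} {ρ lam ε w : ℝ} {p : Mat d × Mat d}
    (hρ : 0 ≤ ρ) (hlam : 0 < lam) (hp : IsFixed S ρ lam p) (hS₀ : S₀.PosDef) (hε : 0 < ε)
    (hS₀ε : (S₀ - ε • (1 : Mat d)).PosSemidef) (hw : 0 ≤ w) (hW : ∀ i j, |(S - S₀) i j| ≤ w)
    (hsmall : d * (w + ρ) < ε ^ 2 / (1 + ε)) :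
    frob (p.1 - S₀⁻¹) ≤ 1 ∧ ε ^ 2 / (1 + ε) * frob (p.1 - S₀⁻¹) ≤ d * (w + ρ) := by
  have h := hp.basic_inequality hS₀ hε hS₀ε
  have h1 := neg_frobInner_le (D := p.1 - S₀⁻¹) hw hW
  have h2 := neg_frobInner_le (D := p.1 - S₀⁻¹) hρ (hp.abs_residual_le hρ hlam)
  have hx := frob_nonneg (p.1 - S₀⁻¹)
  obtain ⟨h3, h4⟩ := self_bounding (β := d * (w + ρ)) (γ := 0) hε hx le_rfl (by simpa using hsmall)
    (by linarith)
  refine ⟨h3, ?_⟩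
  rcases hx.eq_or_lt with h0 | h0
  · rw [← h0, mul_zero]; positivity
  · refine le_of_mul_le_mul_right ?_ h0
    linarith [h4]

lemma huber_residual {t lam ρ : ℝ} (hlam : 0 < lam) (hρ : 0 ≤ ρ) (ht : t = ρ / lam) (x : ℝ) :
    ρ * |x| ≤ lam * (x - shrink t x) * x + ρ ^ 2 / (4 * lam) := by
  have ht0 : 0 ≤ t := by rw [ht]; positivity
  have h1 := sub_shrink_mul_shrink t x
  set η := shrink t x
  have hρt : ρ = lam * t := by rw [ht]; field_simp
  have h2 : |x| ≤ |η| + |x - η| := by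
    have := abs_add_le η (x - η); simpa using this
  have h3 : ρ ^ 2 / (4 * lam) = lam * t ^ 2 / 4 := by rw [hρt]; field_simp
  have h4 : |x - η| * |x - η| = (x - η) * (x - η) := abs_mul_abs_self _
  rw [h3, hρt]
  -- Since (x - η)x = t|η| + |x - η|², it remains to complete the square in |x - η|.
  have h5 : t * |x| ≤ (x - η) * x + t ^ 2 / 4 := by
    nlinarith [sq_nonneg (|x - η| - t / 2), mul_le_mul_of_nonneg_left h2 ht0]
  nlinarith [mul_le_mul_of_nonneg_left h5 hlam.le]

/-- The diagonal together with the support of `A`. -/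
def extSupport (A : Mat d) : Finset (Fin d × Fin d) :=
  open scoped Classical in Finset.univ.filter fun q => q.1 = q.2 ∨ A q.1 q.2 ≠ 0

lemma card_extSupport_le {A : Mat d} {s : ℕ}
    (h : Set.ncard {q : Fin d × Fin d | q.1 ≠ q.2 ∧ A q.1 q.2 ≠ 0} ≤ s) :
    (extSupport A).card ≤ d + s := by
  classical
  have h1 : extSupport A ⊆ (Finset.univ.filter fun q : Fin d × Fin d => q.1 = q.2) ∪
      (Finset.univ.filter fun q : Fin d × Fin d => q.1 ≠ q.2 ∧ A q.1 q.2 ≠ 0) := by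
    intro q hq
    simp only [extSupport, Finset.mem_filter, Finset.mem_univ, true_and] at hq
    simp only [Finset.mem_union, Finset.mem_filter, Finset.mem_univ, true_and]
    tauto
  refine (Finset.card_le_card h1).trans ((Finset.card_union_le _ _).trans (add_le_add ?_ ?_))
  · refine (Finset.card_le_card_of_injOn (t := (Finset.univ : Finset (Fin d))) (fun q => q.1)
      (by simp) ?_).trans (by simp)
    rintro ⟨a, b⟩ hq ⟨a', b'⟩ hq' h
    simp at hq hq' h
    subst hq hq' h
    rfl
  · rw [← Set.ncard_coe_finset]
    simpa using h

/-- Off `extSupport S₀⁻¹` the error entry is that of Θ itself, so by `huber_residual` the residual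
cancels the noise up to ρ²/λ. On the at most d + s remaining entries, noise and residual each cost
ρ|D|, and Cauchy–Schwarz yields the factor √(d + s). -/
lemma IsFixed.frob_sub_le_sparse {S S₀ : Mat d} {ρ lam ε : ℝ} {s : ℕ} {p : Mat d × Mat d}
    (hρ : 0 ≤ ρ) (hlam : 0 < lam) (hp : IsFixed S ρ lam p) (hS₀ : S₀.PosDef) (hε : 0 < ε)
    (hS₀ε : (S₀ - ε • (1 : Mat d)).PosSemidef) (hW : ∀ i j, |(S - S₀) i j| ≤ ρ)
    (hs : Set.ncard {q : Fin d × Fin d | q.1 ≠ q.2 ∧ S₀⁻¹ q.1 q.2 ≠ 0} ≤ s)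
    (hsmall : 2 * ρ * Real.sqrt (d + s) + d ^ 2 * ρ ^ 2 / lam < ε ^ 2 / (1 + ε)) :
    ε ^ 2 / (1 + ε) * frob (p.1 - S₀⁻¹) ^ 2 ≤
      2 * ρ * Real.sqrt (d + s) * frob (p.1 - S₀⁻¹) + d ^ 2 * ρ ^ 2 / lam := by
  classical
  have h := hp.basic_inequality hS₀ hε hS₀ε
  set D := p.1 - S₀⁻¹ with hD
  have hx := frob_nonneg D
  set T := extSupport S₀⁻¹ with hT
  have hentry : ∀ q : Fin d × Fin d,
      -((S - S₀) q.1 q.2 * D q.1 q.2) - (lam • (p.1 - p.2)) q.1 q.2 * D q.1 q.2 ≤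
        2 * ρ * ((if q ∈ T then 1 else 0) * |D q.1 q.2|) + ρ ^ 2 / lam := by
    rintro ⟨i, j⟩
    have h0 : 0 ≤ ρ ^ 2 / lam := by positivity
    have h1 : -((S - S₀) i j * D i j) ≤ ρ * |D i j| := by
      rw [← neg_mul]
      exact mul_le_of_abs_le (by rw [abs_neg]; exact hW i j) _
    by_cases hq : (i, j) ∈ T
    · have h2 : -((lam • (p.1 - p.2)) i j * D i j) ≤ ρ * |D i j| := by
        rw [← neg_mul]
        exact mul_le_of_abs_le (by rw [abs_neg]; exact hp.abs_residual_le hρ hlam i j) _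
      simp only [hq, if_true, one_mul]
      linarith
    · have h3 : S₀⁻¹ i j = 0 := by
        simp only [hT, extSupport, Finset.mem_filter, Finset.mem_univ, true_and, not_or,
          not_not] at hq
        exact hq.2
      have h4 : D i j = p.1 i j := by simp [hD, h3]
      have h5 := huber_residual hlam hρ rfl (p.1 i j)
      have h6 : (lam • (p.1 - p.2)) i j = lam * (p.1 i j - shrink (ρ / lam) (p.1 i j)) := by
        conv_lhs => rw [hp.soft]
        simp [softThreshold_apply]
      have h7 : ρ ^ 2 / (4 * lam) ≤ ρ ^ 2 / lam := by
        gcongr; linarith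
      simp only [hq, if_false, zero_mul, mul_zero, zero_add]
      rw [h6, h4]
      rw [h4] at h1
      linarith
  have hsum : -frobInner (S - S₀) D - frobInner (lam • (p.1 - p.2)) D ≤
      2 * ρ * ∑ q : Fin d × Fin d, (if q ∈ T then 1 else 0) * |D q.1 q.2| +
        d ^ 2 * ρ ^ 2 / lam := by
    have e1 : -frobInner (S - S₀) D - frobInner (lam • (p.1 - p.2)) D =
        ∑ q : Fin d × Fin d,
          (-((S - S₀) q.1 q.2 * D q.1 q.2) - (lam • (p.1 - p.2)) q.1 q.2 * D q.1 q.2) := by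
      simp only [frobInner, Fintype.sum_prod_type, Finset.sum_sub_distrib, Finset.sum_neg_distrib]
    rw [e1]
    refine (Finset.sum_le_sum fun q _ => hentry q).trans (le_of_eq ?_)
    rw [Finset.sum_add_distrib, Finset.mul_sum]
    simp
    ring
  have hCS : ∑ q : Fin d × Fin d, (if q ∈ T then (1 : ℝ) else 0) * |D q.1 q.2| ≤
      Real.sqrt (d + s) * frob D := by
    refine (Real.sum_mul_le_sqrt_mul_sqrt _ _ _).trans ?_
    have e2 : Real.sqrt (∑ q : Fin d × Fin d, |D q.1 q.2| ^ 2) = frob D := by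
      simp [frob, Fintype.sum_prod_type, sq_abs]
    rw [e2]
    refine mul_le_mul_of_nonneg_right (Real.sqrt_le_sqrt ?_) hx
    have : ∑ q : Fin d × Fin d, (if q ∈ T then (1 : ℝ) else 0) ^ 2 = T.card := by
      simp [ite_pow]
    rw [this]
    exact_mod_cast card_extSupport_le hs
  have hβ : (ε⁻¹ + frob D)⁻¹ * ε * frob D ^ 2 ≤
      2 * ρ * Real.sqrt (d + s) * frob D + d ^ 2 * ρ ^ 2 / lam := by
    have := mul_le_mul_of_nonneg_left hCS (by positivity : 0 ≤ 2 * ρ)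
    linarith
  exact (self_bounding hε hx (by positivity) hsmall hβ).2

/-! ### Spectral bounds for the iterates -/

/-- An eigenvalue θ > B of Θ would have 1/θ ≤ e/2, while testing stationarity on its eigenvector
gives λθ - 1/θ ≤ λB + e/2 - e; hence θ ≤ B, a contradiction. The excess e/(2λ) of Z is thus
absorbed. -/
lemma IsThetaStep.upper_bound {S Z Θ : Mat d} {lam e B : ℝ} (hlam : 0 < lam) (he : 0 < e)
    (hB : 2 / e ≤ B) (h : IsThetaStep S lam Z Θ) (hS : (S - e • (1 : Mat d)).PosSemidef)
    (hZ : ((B + e / (2 * lam)) • (1 : Mat d) - Z).PosSemidef) :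
    (B • (1 : Mat d) - Θ).PosSemidef := by
  have hΘs := isSymm_of_posDef h.posDef
  have hB0 : 0 < B := lt_of_lt_of_le (by positivity) hB
  refine posSemidef_of_eigenpairs (by simp [IsSymm, hΘs.eq]) fun v θ' hv hvθ => ?_
  by_contra! hneg
  set θ := B - θ' with hθ
  have hθB : B < θ := by linarith
  have hΘv : Θ *ᵥ v = θ • v := by
    rw [sub_mulVec, smul_mulVec, one_mulVec] at hvθ
    rw [hθ, sub_smul, ← hvθ]
    abel
  have hθ0 : 0 < θ := hB0.trans hθB
  have hinv : Θ⁻¹ *ᵥ v = θ⁻¹ • v := by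
    have : Θ⁻¹ *ᵥ (Θ *ᵥ v) = v := by rw [mulVec_mulVec, posDef_inv_mul h.posDef, one_mulVec]
    rw [hΘv, mulVec_smul] at this
    conv_rhs => rw [← this, smul_smul, inv_mul_cancel₀ hθ0.ne', one_smul]
  have hvv : 0 < v ⬝ᵥ v := by simpa using dotProduct_star_self_pos_iff.2 hv
  have h1 : (lam * θ - θ⁻¹) * (v ⬝ᵥ v) = lam * (v ⬝ᵥ Z *ᵥ v) - v ⬝ᵥ S *ᵥ v := by
    have := congrArg (fun A => v ⬝ᵥ A *ᵥ v) h.eq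
    simp only [sub_mulVec, smul_mulVec, dotProduct_sub, dotProduct_smul, hΘv, hinv,
      smul_eq_mul] at this
    linarith
  have h2 := dotProduct_le_of_posSemidef hZ v
  have h3 : e * (v ⬝ᵥ v) ≤ v ⬝ᵥ S *ᵥ v := by
    have := hS.dotProduct_mulVec_nonneg v
    simpa [sub_mulVec, smul_mulVec, dotProduct_sub] using this
  have h4 : θ⁻¹ ≤ e / 2 := by
    rw [inv_le_comm₀ hθ0 (by positivity), inv_div]
    linarith
  have h5 : (lam * θ - θ⁻¹) * (v ⬝ᵥ v) ≤ (lam * B - e / 2) * (v ⬝ᵥ v) := by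
    have e1 : lam * ((B + e / (2 * lam)) * (v ⬝ᵥ v)) = (lam * B + e / 2) * (v ⬝ᵥ v) := by
      field_simp
    have := mul_le_mul_of_nonneg_left h2 hlam.le
    nlinarith
  have h6 := le_of_mul_le_mul_right h5 hvv
  nlinarith [mul_lt_mul_of_pos_left hθB hlam]

lemma IsAM.upper_bound {S : Mat d} {ρ lam e B : ℝ} {Θ Z : ℕ → Mat d} (h : IsAM S ρ lam Θ Z)
    (hρ : 0 ≤ ρ) (hlam : 0 < lam) (he : 0 < e) (hB : 2 / e ≤ B) (hSs : S.IsSymm)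
    (hS : (S - e • (1 : Mat d)).PosSemidef) (hZs : (Z 0).IsSymm)
    (hZ : (B • (1 : Mat d) - Z 0).PosSemidef) (hρd : d * ρ ≤ e / 2) (k : ℕ) :
    (B • (1 : Mat d) - Θ (k + 1)).PosSemidef := by
  have hstep := h.isThetaStep hlam hSs hZs
  suffices hZk : ((B + e / (2 * lam)) • (1 : Mat d) - Z k).PosSemidef from
    (hstep k).upper_bound hlam he hB hS hZk
  induction k with
  | zero => exact posSemidef_smul_one_sub_mono (by have : 0 < e / (2 * lam) := by positivity
                                                   linarith) hZ
  | succ k ih =>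
    have hΘ := (hstep k).upper_bound hlam he hB hS ih
    have hΘs := isSymm_of_posDef (hstep k).posDef
    have hE : (Z (k + 1) - Θ (k + 1)).IsSymm := by
      simp [IsSymm, (h.isSymm hlam hSs hZs (k + 1)).eq, hΘs.eq]
    -- Thresholding moves each entry by at most ρ/λ, so the excess is regenerated at the same size
    -- in each sweep and does not accumulate.
    have hf : frob (Z (k + 1) - Θ (k + 1)) ≤ e / (2 * lam) := by
      rw [frob_sub_comm, (h k).2]
      refine (frob_le_of_abs_le (t := ρ / lam) (by positivity) fun i j =>
        abs_sub_shrink_le (by positivity) _).trans ?_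
      rw [mul_div_assoc', div_le_div_iff₀ hlam (by positivity)]
      nlinarith
    have := hΘ.add (posSemidef_of_frob_le hE hf)
    convert this using 1
    rw [add_smul]
    abel

lemma IsAM.contraction {S S₀ : Mat d} {ρ lam ε w z₀ : ℝ} {p : Mat d × Mat d} {Θ Z : ℕ → Mat d}
    (hρ : 0 ≤ ρ) (hlam : 0 < lam) (hz₀ : 0 ≤ z₀) (hp : IsFixed S ρ lam p) (h : IsAM S ρ lam Θ Z)
    (hSs : S.IsSymm) (hS₀ : S₀.PosDef) (hε : 0 < ε)
    (hS₀ε : (S₀ - ε • (1 : Mat d)).PosSemidef) (hw : 0 ≤ w) (hW : ∀ i j, |(S - S₀) i j| ≤ w)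
    (hdw : d * w ≤ ε / 2) (hdρ : d * ρ ≤ ε / 4) (hclose : frob (p.1 - S₀⁻¹) ≤ 1)
    (hZs : (Z 0).IsSymm) (hZ : specNorm (Z 0) ≤ z₀) (k : ℕ)
    (hk : 1 ≤ k ∨ Z 0 = softThreshold (ρ / lam) (Θ 0)) :
    frob (Θ (k + 1) - p.1) ≤
      lam / (lam + (z₀ + 4 / ε + 1)⁻¹ * (z₀ + 4 / ε + 1)⁻¹) * frob (Θ k - p.1) := by
  -- z₀ covers the start, 4/ε is 2/e for the lower bound e = ε/2 on S, and 4/ε + 1 also dominates Θ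
  -- ⪯ ε⁻¹ + 1 at the minimizer.
  set B := z₀ + 4 / ε + 1 with hB
  have h4 : 0 < 4 / ε := by positivity
  have hB0 : 0 < B := by positivity
  have hS₀s := isSymm_of_posDef hS₀
  have hSe : (S - (ε / 2) • (1 : Mat d)).PosSemidef := by
    have hE : (S₀ - S).IsSymm := by simp [IsSymm, hSs.eq, hS₀s.eq]
    have hf : frob (S₀ - S) ≤ ε / 2 := by
      rw [frob_sub_comm]
      exact (frob_le_of_abs_le hw hW).trans hdw
    have := hS₀ε.add (posSemidef_of_frob_le hE hf)
    convert this using 1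
    have e1 : ε • (1 : Mat d) = (ε / 2) • 1 + (ε / 2) • 1 := by rw [← add_smul, add_halves]
    rw [e1]
    abel
  have hup := h.upper_bound (e := ε / 2) (B := B) hρ hlam (by positivity)
    (by rw [div_div_eq_mul_div]; norm_num; linarith) hSs hSe hZs
    (posSemidef_of_specNorm_le hZs (by linarith)) (by linarith)
  have hpB : (B • (1 : Mat d) - p.1).PosSemidef := by
    have hDs : (p.1 - S₀⁻¹).IsSymm := by
      simp [IsSymm, (isSymm_of_posDef hp.step.posDef).eq, (isSymm_of_posDef hS₀.inv).eq]
    have h1 := (posSemidef_sub_inv hS₀ hε hS₀ε).add (posSemidef_of_frob_le hDs hclose)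
    refine posSemidef_smul_one_sub_mono (b := ε⁻¹ + 1) ?_ ?_
    · have : ε⁻¹ ≤ 4 / ε := by rw [inv_eq_one_div]; gcongr; norm_num
      linarith
    · convert h1 using 1
      rw [add_smul]; abel
  refine ((h.isThetaStep hlam hSs hZs k).contraction hlam hB0 hp.step (hup k) hpB).trans ?_
  refine mul_le_mul_of_nonneg_left ?_ (contraction_factor_pos hlam).le
  -- At k = 0 the iterates are free, so this has to be assumed there.
  have hZk : Z k = softThreshold (ρ / lam) (Θ k) := by
    rcases k with _ | k
    · simpa using hk
    · exact (h k).2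
  rw [hZk, hp.soft]
  exact frob_softThreshold_sub_le (by positivity) _ _

end Deterministic

/-! ### Concentration of the sample covariance -/

section Concentration

variable {Ω : Type*} [MeasurableSpace Ω] {P : Measure Ω}

/-- Chernoff's bound for independent variables whose moment generating function is dominated by
that of a centered Gaussian near the origin. -/
lemma measure_abs_sum_gt_le [IsProbabilityMeasure P] {m : ℕ} {Y : Fin m → Ω → ℝ}
    (hind : iIndepFun Y P)
    (hmeas : ∀ l, AEMeasurable (Y l) P) {a s₀ t : ℝ} (ha : 0 < a) (ht0 : 0 ≤ t)
    (ht : t ≤ 2 * a * s₀)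
    (hmgf : ∀ l s, |s| ≤ s₀ → 0 < mgf (Y l) P s ∧ mgf (Y l) P s ≤ Real.exp (a * s ^ 2)) :
    P {ω | m * t < |∑ l, Y l ω|} ≤ ENNReal.ofReal (2 * Real.exp (-(m * t ^ 2 / (4 * a)))) := by
  have hs0 : 0 ≤ t / (2 * a) := by positivity
  have hs1 : t / (2 * a) ≤ s₀ := by rw [div_le_iff₀ (by positivity)]; linarith
  have hsum : ∀ s, |s| ≤ s₀ → Integrable (fun ω => Real.exp (s * (∑ l, Y l) ω)) P ∧
      mgf (∑ l, Y l) P s ≤ Real.exp (m * (a * s ^ 2)) := by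
    intro s hs
    have h1 : mgf (∑ l, Y l) P s = ∏ l, mgf (Y l) P s := hind.mgf_sum₀ hmeas _
    refine ⟨?_, ?_⟩
    -- `mgf` takes the value 0 when the exponential is not integrable, so positivity of the factors
    -- gives integrability.
    · by_contra hni
      have h2 := mgf_undef hni
      rw [h1] at h2
      exact (Finset.prod_pos fun l _ => (hmgf l s hs).1).ne' h2
    · rw [h1]
      calc ∏ l, mgf (Y l) P s ≤ ∏ _l : Fin m, Real.exp (a * s ^ 2) :=
            Finset.prod_le_prod (fun l _ => (hmgf l s hs).1.le) fun l _ => (hmgf l s hs).2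
        _ = _ := by rw [Finset.prod_const, Finset.card_univ, Fintype.card_fin, ← Real.exp_nat_mul]
  have hexp : ∀ s, s = t / (2 * a) → -s * (m * t) + m * (a * s ^ 2) = -(m * t ^ 2 / (4 * a)) := by
    rintro s rfl; field_simp; ring
  obtain ⟨hi1, hm1⟩ := hsum (t / (2 * a)) (by rwa [abs_of_nonneg hs0])
  obtain ⟨hi2, hm2⟩ := hsum (-(t / (2 * a))) (by rwa [abs_neg, abs_of_nonneg hs0])
  have hup : P.real {ω | m * t ≤ (∑ l, Y l) ω} ≤ Real.exp (-(m * t ^ 2 / (4 * a))) := by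
    refine (measure_ge_le_exp_mul_mgf _ hs0 hi1).trans ?_
    rw [← hexp _ rfl, Real.exp_add]
    gcongr
  have hlo : P.real {ω | (∑ l, Y l) ω ≤ -(m * t)} ≤ Real.exp (-(m * t ^ 2 / (4 * a))) := by
    refine (measure_le_le_exp_mul_mgf _ (neg_nonpos.2 hs0) hi2).trans ?_
    rw [← hexp _ rfl, Real.exp_add, neg_neg, mul_neg, neg_mul]
    rw [neg_sq] at hm2
    gcongr
  have hsub : {ω | m * t < |∑ l, Y l ω|} ⊆
      {ω | m * t ≤ (∑ l, Y l) ω} ∪ {ω | (∑ l, Y l) ω ≤ -(m * t)} := by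
    intro ω hω
    simp only [Set.mem_ofPred_eq] at hω
    simp only [Set.mem_union, Set.mem_ofPred_eq, Finset.sum_apply]
    rcases lt_abs.1 hω with h | h
    · exact Or.inl h.le
    · exact Or.inr (by linarith)
  refine (measure_mono hsub).trans ((measure_union_le _ _).trans ?_)
  rw [two_mul, ENNReal.ofReal_add (Real.exp_pos _).le (Real.exp_pos _).le]
  refine add_le_add ?_ ?_
  · rw [← ofReal_measureReal]; exact ENNReal.ofReal_le_ofReal hup
  · rw [← ofReal_measureReal]; exact ENNReal.ofReal_le_ofReal hlo

lemma exp_neg_le_one_sub_mul {x : ℝ} (hx : |x| ≤ 1 / 2) :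
    Real.exp (-x) ≤ (1 - x) * Real.exp (2 * x ^ 2) := by
  have h1 := Real.abs_log_sub_add_sum_range_le (x := x) (by linarith) 1
  simp only [Finset.sum_range_one, zero_add, pow_one, Nat.cast_zero, div_one, Nat.reduceAdd,
    sq_abs] at h1
  have h2 : x ^ 2 / (1 - |x|) ≤ 2 * x ^ 2 := by
    rw [div_le_iff₀ (by linarith)]
    nlinarith [sq_nonneg x]
  have h3 := (abs_le.1 (h1.trans h2)).1
  have h4 : 0 < 1 - x := by linarith [le_abs_self x]
  calc Real.exp (-x) ≤ Real.exp (Real.log (1 - x) + 2 * x ^ 2) := by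
        apply Real.exp_le_exp.2; linarith
    _ = _ := by rw [Real.exp_add, Real.exp_log h4]

/-- No restriction on s: where the integral diverges, 1 - 2sv ≤ 0 and both sides are 0 by
convention. -/
lemma integral_exp_sq_gaussianReal (v : NNReal) (s : ℝ) :
    ∫ x, Real.exp (s * (x ^ 2 - v)) ∂(gaussianReal 0 v) =
      Real.exp (-(s * v)) * (Real.sqrt (1 - 2 * s * v))⁻¹ := by
  by_cases hv : v = 0
  · simp [hv]
  have hv0 : (0 : ℝ) < v := by positivity
  rw [integral_gaussianReal_eq_integral_smul hv]
  have h1 : ∀ x : ℝ, gaussianPDFReal 0 v x • Real.exp (s * (x ^ 2 - v)) =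
      (Real.sqrt (2 * Real.pi * v))⁻¹ * Real.exp (-(s * v)) *
        Real.exp (-((1 - 2 * s * v) / (2 * v)) * x ^ 2) := by
    intro x
    rw [gaussianPDFReal, smul_eq_mul, mul_assoc (Real.sqrt _)⁻¹, mul_assoc (Real.sqrt _)⁻¹,
      ← Real.exp_add, ← Real.exp_add]
    congr 2
    field_simp
    ring
  simp_rw [h1]
  rw [integral_const_mul, integral_gaussian]
  have h2 : Real.pi / ((1 - 2 * s * v) / (2 * v)) = (2 * Real.pi * v) / (1 - 2 * s * v) := by
    field_simp
  have h3 : 0 < Real.sqrt (2 * Real.pi * v) := Real.sqrt_pos.2 (by positivity)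
  rw [h2, Real.sqrt_div (by positivity)]
  field_simp

lemma mgf_sq_sub_le {g : Ω → ℝ} {v : NNReal} (hg : HasLaw g (gaussianReal 0 v) P) {V s : ℝ}
    (hV : 0 < V) (hv : v ≤ V) (hs : |s| ≤ 1 / (4 * V)) :
    0 < mgf (fun ω => g ω ^ 2 - v) P s ∧
      mgf (fun ω => g ω ^ 2 - v) P s ≤ Real.exp (4 * V ^ 2 * s ^ 2) := by
  set x := 2 * s * v with hx
  have hv0 : (0 : ℝ) ≤ v := v.2
  have hsV : |s| * V ≤ 1 / 4 := by
    have := mul_le_mul_of_nonneg_right hs hV.le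
    calc |s| * V ≤ 1 / (4 * V) * V := this
      _ = 1 / 4 := by field_simp
  have hsv : |s| * v ≤ 1 / 4 := le_trans (by gcongr) hsV
  have hx1 : |x| ≤ 1 / 2 := by
    rw [hx, abs_mul, abs_mul, abs_of_nonneg hv0, abs_two]; linarith
  have hx2 : x < 1 := by linarith [le_abs_self x]
  have e1 : mgf (fun ω => g ω ^ 2 - v) P s =
      Real.exp (-(s * v)) * (Real.sqrt (1 - x))⁻¹ := by
    rw [hx, ← integral_exp_sq_gaussianReal v s]
    exact hg.integral_comp (f := fun y => Real.exp (s * (y ^ 2 - v)))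
      (Measurable.aestronglyMeasurable (by fun_prop))
  have hsq : 0 < Real.sqrt (1 - x) := Real.sqrt_pos.2 (by linarith)
  rw [e1]
  refine ⟨by positivity, ?_⟩
  rw [← div_eq_mul_inv, div_le_iff₀ hsq]
  have h1 := exp_neg_le_one_sub_mul hx1
  -- The square of this inequality is `exp_neg_le_one_sub_mul`, as x = 2sv.
  have h2 : Real.exp (-(s * v)) ≤ Real.exp (x ^ 2) * Real.sqrt (1 - x) := by
    refine le_of_sq_le_sq ?_ (by positivity)
    rw [mul_pow, Real.sq_sqrt (by linarith), ← Real.exp_nat_mul, ← Real.exp_nat_mul]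
    have e2 : ((2 : ℕ) : ℝ) * -(s * v) = -x := by rw [hx]; push_cast; ring
    have e3 : ((2 : ℕ) : ℝ) * x ^ 2 = 2 * x ^ 2 := by push_cast; ring
    rw [e2, e3]
    linarith
  refine h2.trans ?_
  gcongr
  calc x ^ 2 = 4 * (v : ℝ) ^ 2 * s ^ 2 := by rw [hx]; ring
    _ ≤ 4 * V ^ 2 * s ^ 2 := by gcongr

variable {d m : ℕ} {ν : EuclideanSpace ℝ (Fin d)} {S : Mat d}
  {X : Fin m → Ω → EuclideanSpace ℝ (Fin d)}

/-- The linear functional `u` of the centered observation `x`. -/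
def centeredForm (u : Fin d → ℝ) (ν x : EuclideanSpace ℝ (Fin d)) : ℝ := ∑ k, u k * (x k - ν k)

@[fun_prop]
lemma measurable_centeredForm (u : Fin d → ℝ) (ν : EuclideanSpace ℝ (Fin d)) :
    Measurable (centeredForm u ν) := by
  unfold centeredForm
  fun_prop

lemma IsGaussianSample.hasLaw_centeredForm (h : IsGaussianSample P ν S X) (hS : S.PosSemidef)
    (u : Fin d → ℝ) (l : Fin m) :
    HasLaw (fun ω => centeredForm u ν (X l ω)) (gaussianReal 0 (u ⬝ᵥ S *ᵥ u).toNNReal) P := by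
  set L : StrongDual ℝ (EuclideanSpace ℝ (Fin d)) := innerSL ℝ (WithLp.toLp 2 u) with hL
  have hLx : ∀ x, L x = ∑ k, u k * x k := fun x => by
    simp [hL, PiLp.inner_apply, mul_comm]
  have hmean : (multivariateGaussian ν S)[L] = L ν := by
    rw [ContinuousLinearMap.integral_comp_id_comm]
    · simp
    · exact IsGaussian.integrable_id
  have hvar : Var[L; multivariateGaussian ν S] = u ⬝ᵥ S *ᵥ u := by
    have h1 := covarianceBilin_self (μ := multivariateGaussian ν S) IsGaussian.memLp_two_id
      (WithLp.toLp 2 u)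
    rw [covarianceBilin_multivariateGaussian hS] at h1
    rw [h1]
    rfl
  have hlaw : HasLaw L (gaussianReal (L ν) (u ⬝ᵥ S *ᵥ u).toNNReal) (multivariateGaussian ν S) :=
    ⟨by fun_prop, by rw [IsGaussian.map_eq_gaussianReal, hmean, hvar]⟩
  have h2 := gaussianReal_sub_const (hlaw.comp (h.law l)) (L ν)
  rw [sub_self] at h2
  convert h2 using 1
  ext ω
  simp [centeredForm, hLx, mul_sub, Finset.sum_sub_distrib]

lemma IsGaussianSample.iIndepFun_comp (h : IsGaussianSample P ν S X)
    {f : EuclideanSpace ℝ (Fin d) → ℝ} (hf : Measurable f) :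
    iIndepFun (fun l ω => f (X l ω)) P :=
  h.indep.comp (fun _ => f) fun _ => hf

lemma IsGaussianSample.measure_sum_sq_gt_le [IsProbabilityMeasure P]
    (h : IsGaussianSample P ν S X) (hS : S.PosSemidef)
    (u : Fin d → ℝ) {V t : ℝ} (hV : 0 < V) (huV : u ⬝ᵥ S *ᵥ u ≤ V) (ht0 : 0 ≤ t)
    (ht : t ≤ 2 * V) :
    P {ω | m * t < |∑ l, (centeredForm u ν (X l ω) ^ 2 - u ⬝ᵥ S *ᵥ u)|} ≤
      ENNReal.ofReal (2 * Real.exp (-(m * t ^ 2 / (16 * V ^ 2)))) := by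
  have hnn : 0 ≤ u ⬝ᵥ S *ᵥ u := by simpa using hS.dotProduct_mulVec_nonneg u
  have hlaw := h.hasLaw_centeredForm hS u
  have hcoe : (((u ⬝ᵥ S *ᵥ u).toNNReal : NNReal) : ℝ) = u ⬝ᵥ S *ᵥ u := Real.coe_toNNReal _ hnn
  have hmgf := fun l s (hs : |s| ≤ 1 / (4 * V)) =>
    mgf_sq_sub_le (hlaw l) hV (hcoe.trans_le huV) hs
  rw [hcoe] at hmgf
  have key := measure_abs_sum_gt_le (a := 4 * V ^ 2) (t := t)
    (h.iIndepFun_comp (f := fun x => centeredForm u ν x ^ 2 - u ⬝ᵥ S *ᵥ u) (by fun_prop))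
    (fun l => ((hlaw l).aemeasurable.pow_const 2).sub_const _) (by positivity) ht0
    (by have : 2 * (4 * V ^ 2) * (1 / (4 * V)) = 2 * V := by field_simp
        rwa [this]) hmgf
  convert key using 5
  ring

lemma IsGaussianSample.measure_sum_gt_le [IsProbabilityMeasure P]
    (h : IsGaussianSample P ν S X) (hS : S.PosSemidef)
    (u : Fin d → ℝ) {V t : ℝ} (hV : 0 < V) (huV : u ⬝ᵥ S *ᵥ u ≤ V) (ht0 : 0 ≤ t) :
    P {ω | m * t < |∑ l, centeredForm u ν (X l ω)|} ≤
      ENNReal.ofReal (2 * Real.exp (-(m * t ^ 2 / (2 * V)))) := by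
  have hnn : 0 ≤ u ⬝ᵥ S *ᵥ u := by simpa using hS.dotProduct_mulVec_nonneg u
  have hlaw := h.hasLaw_centeredForm hS u
  -- The Gaussian bound holds for every s; this s₀ makes the range condition an equality.
  have key := measure_abs_sum_gt_le (a := V / 2) (t := t) (s₀ := t / V)
    (h.iIndepFun_comp (f := centeredForm u ν) (by fun_prop))
    (fun l => (hlaw l).aemeasurable) (by positivity) ht0
    (by have : 2 * (V / 2) * (t / V) = t := by field_simp
        rw [this]) (fun l s _ => by
      rw [mgf_gaussianReal (hlaw l).map_eq]
      refine ⟨Real.exp_pos _, Real.exp_le_exp.2 ?_⟩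
      rw [Real.coe_toNNReal _ hnn]
      nlinarith [sq_nonneg s])
  convert key using 5
  ring

end Concentration

/-! ### Entrywise deviation of the sample covariance. -/

section Deviation

variable {Ω : Type*} [MeasurableSpace Ω] {P : Measure Ω} {d m : ℕ}
  {ν : EuclideanSpace ℝ (Fin d)} {S : Mat d} {X : Fin m → Ω → EuclideanSpace ℝ (Fin d)}

lemma isSymm_sampleCov (x : Fin m → EuclideanSpace ℝ (Fin d)) : (sampleCov x).IsSymm := by
  ext i j
  simp [sampleCov, mul_comm]

lemma sampleCov_apply_eq (hm : 1 ≤ m) (x : Fin m → EuclideanSpace ℝ (Fin d))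
    (ν : EuclideanSpace ℝ (Fin d)) (i j : Fin d) :
    sampleCov x i j = (∑ l, (x l i - ν i) * (x l j - ν j)) / m -
      (∑ l, (x l i - ν i)) / m * ((∑ l, (x l j - ν j)) / m) := by
  have hm0 : (m : ℝ) ≠ 0 := by positivity
  have h1 : ∀ i, ∑ l, (x l i - ν i) = m * (sampleMean x i - ν i) := fun i => by
    simp [sampleMean, Finset.sum_sub_distrib]
    field_simp
  have h2 : ∑ l, (x l i - sampleMean x i) * (x l j - sampleMean x j) =
      ∑ l, (x l i - ν i) * (x l j - ν j) - (sampleMean x j - ν j) * ∑ l, (x l i - ν i) -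
        (sampleMean x i - ν i) * ∑ l, (x l j - ν j) +
        m * ((sampleMean x i - ν i) * (sampleMean x j - ν j)) := by
    rw [Finset.mul_sum, Finset.mul_sum, ← Finset.sum_sub_distrib, ← Finset.sum_sub_distrib]
    have : (m : ℝ) * ((sampleMean x i - ν i) * (sampleMean x j - ν j)) =
        ∑ _l : Fin m, (sampleMean x i - ν i) * (sampleMean x j - ν j) := by simp
    rw [this, ← Finset.sum_add_distrib]
    exact Finset.sum_congr rfl fun l _ => by ring
  simp only [sampleCov, of_apply]
  rw [h2, h1, h1]
  field_simp
  ring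

/-- The vector `e_i + σ e_j`. -/
def pairVec (i j : Fin d) (σ : ℝ) : Fin d → ℝ := Pi.single i 1 + Pi.single j σ

lemma centeredForm_pairVec (i j : Fin d) (σ : ℝ) (ν x : EuclideanSpace ℝ (Fin d)) :
    centeredForm (pairVec i j σ) ν x = (x i - ν i) + σ * (x j - ν j) := by
  simp [centeredForm, pairVec, add_mul, Finset.sum_add_distrib, Pi.single_apply]

lemma pairVec_dotProduct_mulVec (A : Mat d) (i j : Fin d) (σ : ℝ) :
    pairVec i j σ ⬝ᵥ A *ᵥ pairVec i j σ = A i i + σ * A i j + σ * A j i + σ ^ 2 * A j j := by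
  simp [pairVec, mulVec_add, add_dotProduct, dotProduct_add]
  ring

lemma pairVec_quadratic_le {ε₂ : ℝ} (hε₂ : 0 < ε₂) (h : (ε₂ • (1 : Mat d) - S).PosSemidef)
    (i j : Fin d) {σ : ℝ} (hσ : |σ| ≤ 1) :
    pairVec i j σ ⬝ᵥ S *ᵥ pairVec i j σ ≤ 4 * ε₂ := by
  have h1 := dotProduct_le_of_posSemidef h (pairVec i j σ)
  have h2 : pairVec i j σ ⬝ᵥ pairVec i j σ ≤ 4 := by
    have h3 := pairVec_dotProduct_mulVec (1 : Mat d) i j σ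
    rw [one_mulVec] at h3
    rw [h3]
    obtain ⟨h4, h5⟩ := abs_le.1 hσ
    rcases eq_or_ne i j with rfl | hij
    · simp; nlinarith
    · simp [hij, hij.symm]; nlinarith
  nlinarith

/-- The exponential rate in the tail bound for the entries of the sample covariance. -/
def tailRate (ε₂ : ℝ) : ℝ := 1 / (4 * (256 * ε₂ ^ 2 + 8 * ε₂))

/-- The range of deviations to which the tail bound applies. -/
def tailRange (ε₂ : ℝ) : ℝ := 2 * min 1 (8 * ε₂)

lemma tailRate_pos {ε₂ : ℝ} (h : 0 < ε₂) : 0 < tailRate ε₂ := by unfold tailRate; positivity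

lemma tailRange_pos {ε₂ : ℝ} (h : 0 < ε₂) : 0 < tailRange ε₂ := by unfold tailRange; positivity

/-- Polarization writes the centered second moment as a quarter of the difference of the sums for
e_i + e_j and e_i - e_j, an error of t/2. Replacing the true mean by the sample mean costs t² ≤ t.
-/
lemma abs_sampleCov_sub_le (hS : S.IsSymm) (hm : 1 ≤ m) (x : Fin m → EuclideanSpace ℝ (Fin d))
    (ν : EuclideanSpace ℝ (Fin d)) {t : ℝ} (ht0 : 0 ≤ t) (ht1 : t ≤ 1) (i j : Fin d)
    (h₁ : |∑ l, (centeredForm (pairVec i j 1) ν (x l) ^ 2 -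
      pairVec i j 1 ⬝ᵥ S *ᵥ pairVec i j 1)| ≤ m * t)
    (h₂ : |∑ l, (centeredForm (pairVec i j (-1)) ν (x l) ^ 2 -
      pairVec i j (-1) ⬝ᵥ S *ᵥ pairVec i j (-1))| ≤ m * t)
    (h₃ : |∑ l, centeredForm (pairVec i i 0) ν (x l)| ≤ m * t)
    (h₄ : |∑ l, centeredForm (pairVec j j 0) ν (x l)| ≤ m * t) :
    |(sampleCov x - S) i j| ≤ 2 * t := by
  have hm0 : (0 : ℝ) < m := by positivity
  simp only [centeredForm_pairVec, pairVec_dotProduct_mulVec, zero_mul, add_zero] at h₁ h₂ h₃ h₄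
  set A := ∑ l, ((x l i - ν i + 1 * (x l j - ν j)) ^ 2 -
    (S i i + 1 * S i j + 1 * S j i + 1 ^ 2 * S j j)) with hA
  set B := ∑ l, ((x l i - ν i + -1 * (x l j - ν j)) ^ 2 -
    (S i i + -1 * S i j + -1 * S j i + (-1) ^ 2 * S j j)) with hB
  have hAB : A - B = 4 * ∑ l, (x l i - ν i) * (x l j - ν j) - 4 * (m * S i j) := by
    have e1 : (m : ℝ) * S i j = ∑ _l : Fin m, S i j := by simp
    rw [hA, hB, e1, ← Finset.sum_sub_distrib, Finset.mul_sum, Finset.mul_sum,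
      ← Finset.sum_sub_distrib]
    refine Finset.sum_congr rfl fun l _ => ?_
    rw [hS.apply i j]
    ring
  have hW : (sampleCov x - S) i j = (A - B) / (4 * m) -
      (∑ l, (x l i - ν i)) / m * ((∑ l, (x l j - ν j)) / m) := by
    rw [Matrix.sub_apply, sampleCov_apply_eq hm x ν, hAB]
    field_simp
    ring
  have hAB' : |(A - B) / (4 * m)| ≤ t / 2 := by
    rw [abs_div, abs_of_pos (by positivity : (0 : ℝ) < 4 * m), div_le_iff₀ (by positivity)]
    have := abs_sub A B
    linarith
  have hmean : ∀ u : ℝ, |u| ≤ m * t → |u / m| ≤ t := fun u hu => by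
    rw [abs_div, abs_of_pos hm0, div_le_iff₀ hm0]; linarith
  have hprod : |(∑ l, (x l i - ν i)) / m * ((∑ l, (x l j - ν j)) / m)| ≤ t := by
    rw [abs_mul]
    calc _ ≤ t * t := by gcongr <;> [exact hmean _ h₃; exact hmean _ h₄]
      _ ≤ t := by nlinarith
  rw [hW]
  exact (abs_sub _ _).trans (by linarith)

lemma IsGaussianSample.measure_deviation_le [IsProbabilityMeasure P]
    (h : IsGaussianSample P ν S X) (hS : S.PosSemidef) {ε₂ T : ℝ} (hε₂ : 0 < ε₂)
    (hSε : (ε₂ • (1 : Mat d) - S).PosSemidef) (hm : 1 ≤ m) (hT0 : 0 ≤ T)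
    (hT : T ≤ tailRange ε₂) :
    P {ω | ¬ ∀ i j, |(sampleCov (fun l => X l ω) - S) i j| ≤ T} ≤
      ENNReal.ofReal (8 * d ^ 2 * Real.exp (-(tailRate ε₂ * (m * T ^ 2)))) := by
  set t := T / 2 with ht
  have hTt : T = 2 * t := by rw [ht]; ring
  have ht0 : 0 ≤ t := by positivity
  have ht' : t ≤ min 1 (8 * ε₂) := by unfold tailRange at hT; linarith
  have ht1 : t ≤ 1 := ht'.trans (min_le_left _ _)
  have ht2 : t ≤ 2 * (4 * ε₂) := by linarith [ht'.trans (min_le_right _ _)]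
  set E := Real.exp (-(tailRate ε₂ * (m * T ^ 2))) with hE
  have hmt : 0 ≤ m * t ^ 2 := by positivity
  -- With V = 4ε₂ the two tail bounds have denominators 16V² = 256ε₂² and 2V = 8ε₂; their sum
  -- dominates both. The 4 in `tailRate` is from T = 2t.
  have hEt : tailRate ε₂ * (m * T ^ 2) = m * t ^ 2 / (256 * ε₂ ^ 2 + 8 * ε₂) := by
    rw [hTt, tailRate]; field_simp; ring
  let Q : Fin d → Fin d → ℝ → Set Ω := fun i j σ =>
    {ω | m * t < |∑ l, (centeredForm (pairVec i j σ) ν (X l ω) ^ 2 -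
      pairVec i j σ ⬝ᵥ S *ᵥ pairVec i j σ)|}
  let R : Fin d → Set Ω := fun i => {ω | m * t < |∑ l, centeredForm (pairVec i i 0) ν (X l ω)|}
  have hQ : ∀ i j σ, |σ| ≤ 1 → P (Q i j σ) ≤ ENNReal.ofReal (2 * E) := fun i j σ hσ => by
    refine (h.measure_sum_sq_gt_le hS _ (by positivity : 0 < 4 * ε₂)
      (pairVec_quadratic_le hε₂ hSε i j hσ) ht0 ht2).trans (ENNReal.ofReal_le_ofReal ?_)
    rw [hE, hEt]
    gcongr
    nlinarith
  have hR : ∀ i, P (R i) ≤ ENNReal.ofReal (2 * E) := fun i => by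
    refine (h.measure_sum_gt_le hS _ (by positivity : 0 < 4 * ε₂)
      (pairVec_quadratic_le hε₂ hSε i i (by simp)) ht0).trans (ENNReal.ofReal_le_ofReal ?_)
    rw [hE, hEt]
    gcongr
    nlinarith
  have hsub : {ω | ¬ ∀ i j, |(sampleCov (fun l => X l ω) - S) i j| ≤ T} ⊆
      ⋃ q : Fin d × Fin d, ((Q q.1 q.2 1 ∪ Q q.1 q.2 (-1)) ∪ (R q.1 ∪ R q.2)) := by
    intro ω hω
    by_contra hn
    refine hω fun i j => ?_
    simp only [Set.mem_iUnion, not_exists, Set.mem_union, not_or] at hn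
    obtain ⟨⟨h1, h2⟩, h3, h4⟩ := hn (i, j)
    rw [hTt]
    exact abs_sampleCov_sub_le (isSymm_of_posSemidef hS) hm _ ν ht0 ht1 i j
      (not_lt.1 h1) (not_lt.1 h2) (not_lt.1 h3) (not_lt.1 h4)
  have hE0 : 0 ≤ E := (Real.exp_pos _).le
  calc _ ≤ P (⋃ q : Fin d × Fin d, ((Q q.1 q.2 1 ∪ Q q.1 q.2 (-1)) ∪ (R q.1 ∪ R q.2))) :=
        measure_mono hsub
    _ ≤ ∑ q : Fin d × Fin d, P ((Q q.1 q.2 1 ∪ Q q.1 q.2 (-1)) ∪ (R q.1 ∪ R q.2)) :=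
        measure_iUnion_fintype_le _ _
    _ ≤ ∑ _q : Fin d × Fin d, ENNReal.ofReal (8 * E) := by
        refine Finset.sum_le_sum fun q _ => ?_
        have e1 : ENNReal.ofReal (8 * E) = (ENNReal.ofReal (2 * E) + ENNReal.ofReal (2 * E)) +
            (ENNReal.ofReal (2 * E) + ENNReal.ofReal (2 * E)) := by
          rw [← ENNReal.ofReal_add (by positivity) (by positivity),
            ← ENNReal.ofReal_add (by positivity) (by positivity)]
          congr 1; ring
        rw [e1]
        refine (measure_union_le _ _).trans (add_le_add ?_ ?_) <;>
          refine (measure_union_le _ _).trans (add_le_add ?_ ?_)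
        · exact hQ _ _ _ (by simp)
        · exact hQ _ _ _ (by simp)
        · exact hR _
        · exact hR _
    _ = _ := by
        rw [Finset.sum_const, Finset.card_univ, Fintype.card_prod, Fintype.card_fin, nsmul_eq_mul,
          ← ENNReal.ofReal_natCast, ← ENNReal.ofReal_mul (by positivity)]
        congr 1
        push_cast
        ring

lemma IsGaussianSample.measure_deviation_le_of_log [IsProbabilityMeasure P]
    (h : IsGaussianSample P ν S X) (hS : S.PosSemidef) {ε₂ K δ : ℝ} (hε₂ : 0 < ε₂)
    (hSε : (ε₂ • (1 : Mat d) - S).PosSemidef) (hm : 1 ≤ m) (hd : 2 ≤ d) (hδ : 0 < δ) (hK0 : 0 ≤ K)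
    (hK : Real.log (8 / δ) ≤ (tailRate ε₂ * K ^ 2 - 2) * Real.log d)
    (hT : K * Real.sqrt (Real.log d / m) ≤ tailRange ε₂) :
    P {ω | ¬ ∀ i j, |(sampleCov (fun l => X l ω) - S) i j| ≤ K * Real.sqrt (Real.log d / m)} ≤
      ENNReal.ofReal δ := by
  refine (h.measure_deviation_le hS hε₂ hSε hm (by positivity) hT).trans
    (ENNReal.ofReal_le_ofReal ?_)
  have hm0 : (0 : ℝ) < m := by positivity
  have hd0 : (0 : ℝ) < d := by positivity
  have hlog : 0 ≤ Real.log d := Real.log_nonneg (by exact_mod_cast (by omega : 1 ≤ d))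
  have e1 : (m : ℝ) * (K * Real.sqrt (Real.log d / m)) ^ 2 = K ^ 2 * Real.log d := by
    rw [mul_pow, Real.sq_sqrt (by positivity)]
    field_simp
  rw [e1]
  have e2 : 8 * (d : ℝ) ^ 2 = Real.exp (Real.log 8 + 2 * Real.log d) := by
    rw [Real.exp_add, Real.exp_log (by norm_num), two_mul, Real.exp_add, Real.exp_log hd0, sq]
  rw [e2, ← Real.exp_add, ← Real.le_log_iff_exp_le hδ]
  rw [Real.log_div (by norm_num) hδ.ne'] at hK
  linarith

end Deviation

/-! ### Loewner bounds for the true covariance. -/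

lemma TrueModel.posSemidef_sub {d s : ℕ} {ε₁ ε₂ : ℝ} {S : Mat d} (h : TrueModel ε₁ ε₂ s S) :
    (S - ε₁ • (1 : Mat d)).PosSemidef := by
  have := posSemidef_smul_add_smul_one h.herm (α := 1) (β := -ε₁) fun i => by
    linarith [(h.spec i).1]
  simpa [sub_eq_add_neg] using this

lemma TrueModel.sub_posSemidef {d s : ℕ} {ε₁ ε₂ : ℝ} {S : Mat d} (h : TrueModel ε₁ ε₂ s S) :
    (ε₂ • (1 : Mat d) - S).PosSemidef := by
  have := posSemidef_smul_add_smul_one h.herm (α := -1) (β := ε₂) fun i => by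
    linarith [(h.spec i).2]
  simpa [sub_eq_add_neg, add_comm] using this

lemma TrueModel.posDef {d s : ℕ} {ε₁ ε₂ : ℝ} {S : Mat d} (h : TrueModel ε₁ ε₂ s S)
    (hε₁ : 0 < ε₁) : S.PosDef := by
  have := (PosDef.one.smul hε₁).add_posSemidef h.posSemidef_sub
  simpa using this

/-! ### The rate -/

/-- One bound for each argument of the minimum: the first serves the sparse estimate, the second the
dense estimate and the Huber loss d²ρ²/λ. -/
lemma rate_bounds {d s m : ℕ} {lam : ℝ} (hd : 2 ≤ d) (hlam : 0 < lam) :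
    Real.sqrt (Real.log d / m) * Real.sqrt (d + s) ≤ rate d s m lam ∧
      d * Real.sqrt (Real.log d / m) ≤ Real.sqrt lam * rate d s m lam := by
  have hd0 : (0 : ℝ) < d := by positivity
  have hlog : 0 ≤ Real.log d := Real.log_nonneg (by exact_mod_cast (by omega : 1 ≤ d))
  have hq : 0 ≤ Real.log d / m := by positivity
  have hmin : 0 < min (1 / ((d : ℝ) + s)) (lam / (d : ℝ) ^ 2) := by positivity
  constructor
  · rw [← Real.sqrt_mul hq]
    refine Real.sqrt_le_sqrt ?_
    rw [le_div_iff₀ hmin, mul_assoc]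
    refine mul_le_of_le_one_right hq ?_
    calc ((d : ℝ) + s) * min (1 / ((d : ℝ) + s)) (lam / (d : ℝ) ^ 2)
        ≤ ((d : ℝ) + s) * (1 / ((d : ℝ) + s)) := by gcongr; exact min_le_left _ _
      _ = 1 := by field_simp
  · have e1 : (d : ℝ) * Real.sqrt (Real.log d / m) = Real.sqrt (d ^ 2 * (Real.log d / m)) := by
      rw [Real.sqrt_mul (by positivity), Real.sqrt_sq hd0.le]
    rw [e1, rate, ← Real.sqrt_mul hlam.le]
    refine Real.sqrt_le_sqrt ?_
    rw [← mul_div_assoc lam, le_div_iff₀ hmin]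
    calc (d : ℝ) ^ 2 * (Real.log d / m) * min (1 / ((d : ℝ) + s)) (lam / (d : ℝ) ^ 2)
        ≤ (d : ℝ) ^ 2 * (Real.log d / m) * (lam / (d : ℝ) ^ 2) := by
          gcongr; exact min_le_right _ _
      _ = lam * (Real.log d / m) := by field_simp

lemma rate_nonneg (d s m : ℕ) (lam : ℝ) : 0 ≤ rate d s m lam := Real.sqrt_nonneg _

lemma sqrt_log_div_le_rate {d s m : ℕ} {lam : ℝ} (hd : 2 ≤ d) (hlam : 0 < lam) :
    Real.sqrt (Real.log d / m) ≤ rate d s m lam := by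
  refine le_trans ?_ (rate_bounds hd hlam).1
  refine le_mul_of_one_le_right (Real.sqrt_nonneg _) ?_
  rw [Real.one_le_sqrt]
  have : (2 : ℝ) ≤ d := by exact_mod_cast hd
  have : (0 : ℝ) ≤ s := by positivity
  linarith

/-- A deviation level, in units of `√(log d / m)`, that is exceeded with probability at most `δ`
in every dimension `d ≥ 2`. -/
lemma exists_level {ε₂ : ℝ} (hε₂ : 0 < ε₂) (δ : ℝ) :
    ∃ K : ℝ, 0 < K ∧ ∀ d : ℕ, 2 ≤ d →
      Real.log (8 / δ) ≤ (tailRate ε₂ * K ^ 2 - 2) * Real.log d := by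
  have hc := tailRate_pos hε₂
  have hl2 : 0 < Real.log 2 := Real.log_pos (by norm_num)
  have hpos : 0 < (2 + |Real.log (8 / δ)| / Real.log 2) / tailRate ε₂ := by positivity
  refine ⟨Real.sqrt ((2 + |Real.log (8 / δ)| / Real.log 2) / tailRate ε₂),
    Real.sqrt_pos.2 hpos, fun d hd => ?_⟩
  rw [Real.sq_sqrt hpos.le, mul_div_cancel₀ _ hc.ne', add_sub_cancel_left]
  have h1 : Real.log 2 ≤ Real.log d := Real.log_le_log (by norm_num) (by exact_mod_cast hd)
  calc Real.log (8 / δ) ≤ |Real.log (8 / δ)| := le_abs_self _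
    _ = |Real.log (8 / δ)| / Real.log 2 * Real.log 2 := by field_simp
    _ ≤ _ := by gcongr

/-- The contraction factor of alternating minimization. -/
def amFactor (ε₁ z₀ lam : ℝ) : ℝ :=
  lam / (lam + (z₀ + 4 / ε₁ + 1)⁻¹ * (z₀ + 4 / ε₁ + 1)⁻¹)

/-- The threshold for the regularization parameter, in units of `√(log d / m)`. -/
def regThreshold (ε₂ : ℝ) : ℝ := Real.sqrt (3 / tailRate ε₂)

lemma regThreshold_pos {ε₂ : ℝ} (h : 0 < ε₂) : 0 < regThreshold ε₂ :=
  Real.sqrt_pos.2 (div_pos (by norm_num) (tailRate_pos h))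

/-! ### Recovery -/

/-- For fixed λ, d√(log d / m) ≤ √λ · `rate` is small, so the dense estimate suffices and no lower
bound on ρ beyond 0 is needed. The price is a constant proportional to √λ. -/
lemma recovery_fixed_lam {ε₁ ε₂ z₀ b δ lam : ℝ} (hε₁ : 0 < ε₁) (hε : ε₁ ≤ ε₂) (hz₀ : 0 ≤ z₀)
    (hb : 0 < b) (hδ : 0 < δ) (hlam : 0 < lam) :
    ∃ M r₀ : ℝ, 0 < M ∧ 0 < r₀ ∧
      ∀ (d s m : ℕ) (ρ : ℝ), 2 ≤ d → 1 ≤ m → rate d s m lam ≤ r₀ →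
        0 ≤ ρ → ρ ≤ b * Real.sqrt (Real.log d / m) →
        ∀ S : Mat d, TrueModel ε₁ ε₂ s S →
        ∀ (Ω : Type u) [MeasurableSpace Ω] (P : Measure Ω) [IsProbabilityMeasure P]
          (ν : EuclideanSpace ℝ (Fin d)) (X : Fin m → Ω → EuclideanSpace ℝ (Fin d)),
          IsGaussianSample P ν S X →
          P {ω | ¬ ∀ p, IsPenaltyMin (sampleCov fun l => X l ω) ρ lam (sym d) p →
            frob (p.1 - S⁻¹) ≤ M * rate d s m lam ∧
            ∀ Θ Z : ℕ → Mat d, IsAM (sampleCov fun l => X l ω) ρ lam Θ Z →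
              Z 0 ∈ sym d → specNorm (Z 0) ≤ z₀ →
              ∀ k, (1 ≤ k ∨ Z 0 = softThreshold (ρ / lam) (Θ 0)) →
                frob (Θ (k + 1) - p.1) ≤ amFactor ε₁ z₀ lam * frob (Θ k - p.1)}
            ≤ ENNReal.ofReal δ := by
  have hε₂ : 0 < ε₂ := hε₁.trans_le hε
  obtain ⟨K, hK0, hK⟩ := exists_level hε₂ δ
  have hκ : 0 < ε₁ ^ 2 / (1 + ε₁) := by positivity
  have hsl : 0 < Real.sqrt lam := Real.sqrt_pos.2 hlam
  -- N adds up the coefficients of all smallness conditions, so the single bound N r ≤ μ implies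
  -- each of them.
  set N := (K + b) * Real.sqrt lam + K + 1 with hN
  have hN0 : 0 < N := by positivity
  set μ := min (min (ε₁ ^ 2 / (1 + ε₁) / 2) (ε₁ / 4)) (tailRange ε₂) with hμ
  have hμ0 : 0 < μ := lt_min (lt_min (by positivity) (by positivity)) (tailRange_pos hε₂)
  have hμ1 : μ ≤ ε₁ ^ 2 / (1 + ε₁) / 2 := (min_le_left _ _).trans (min_le_left _ _)
  have hμ2 : μ ≤ ε₁ / 4 := (min_le_left _ _).trans (min_le_right _ _)
  have hμ3 : μ ≤ tailRange ε₂ := min_le_right _ _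
  refine ⟨(K + b) * Real.sqrt lam / (ε₁ ^ 2 / (1 + ε₁)), μ / N, by positivity, by positivity,
    fun d s m ρ hd hm hr hρ hρb S hS Ω _ P _ ν X hX => ?_⟩
  set r := rate d s m lam with hrdef
  set q := Real.sqrt (Real.log d / m) with hq
  have hq0 : 0 ≤ q := Real.sqrt_nonneg _
  have hr0 : 0 ≤ r := rate_nonneg _ _ _ _
  have hNr : N * r ≤ μ := by rwa [le_div_iff₀' hN0] at hr
  have hdq : d * q ≤ Real.sqrt lam * r := (rate_bounds hd hlam).2
  have hqr : q ≤ r := sqrt_log_div_le_rate hd hlam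
  have hNr' : (K + b) * (Real.sqrt lam * r) + K * r + r ≤ μ := by
    calc _ = N * r := by rw [hN]; ring
      _ ≤ μ := hNr
  have hKr : 0 ≤ K * r := by positivity
  have hKq : K * q ≤ K * r := by gcongr
  have hslr : 0 ≤ Real.sqrt lam * r := by positivity
  have hKl : 0 ≤ K * (Real.sqrt lam * r) := by positivity
  have hbl : 0 ≤ b * (Real.sqrt lam * r) := by positivity
  have hS₀ := hS.posDef hε₁
  refine le_trans (measure_mono ?_) (hX.measure_deviation_le_of_log hS₀.posSemidef hε₂
    hS.sub_posSemidef hm hd hδ hK0.le (hK d hd) (by linarith))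
  intro ω hω hW
  refine hω fun p hp => ?_
  have hSs := isSymm_sampleCov fun l => X l ω
  have hfix := hp.isFixed hρ hlam hSs
  have hdρ : d * ρ ≤ b * (Real.sqrt lam * r) := by
    calc d * ρ ≤ d * (b * q) := by gcongr
      _ = b * (d * q) := by ring
      _ ≤ _ := by gcongr
  have hdw : d * (K * q) ≤ K * (Real.sqrt lam * r) := by
    calc d * (K * q) = K * (d * q) := by ring
      _ ≤ _ := by gcongr
  have hsum : d * (K * q + ρ) ≤ (K + b) * (Real.sqrt lam * r) := by linarith
  obtain ⟨hx1, hx2⟩ := hfix.frob_sub_le_dense hρ hlam hS₀ hε₁ hS.posSemidef_sub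
    (mul_nonneg hK0.le hq0) hW (by linarith)
  refine ⟨?_, fun Θ Z hAM hZs hZ k hk => ?_⟩
  · rw [div_mul_eq_mul_div, le_div_iff₀ hκ]
    linarith
  · exact hAM.contraction hρ hlam hz₀ hfix hSs hS₀ hε₁ hS.posSemidef_sub
      (mul_nonneg hK0.le hq0) hW (by linarith) (by linarith) hx1 hZs hZ k hk

lemma le_of_quadratic {κ b r x : ℝ} (hκ : 0 < κ) (hr : 0 ≤ r)
    (h : κ * x ^ 2 ≤ 2 * b * r * x + b ^ 2 * r ^ 2) :
    x ≤ (2 / κ * (2 * b ^ 2 / κ + b ^ 2) + 1) * r := by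
  have hN : 0 ≤ 2 / κ * (2 * b ^ 2 / κ + b ^ 2) := by positivity
  set N := 2 / κ * (2 * b ^ 2 / κ + b ^ 2) with hNdef
  -- Half of κx² absorbs the linear term, leaving x² ≤ N r²; then N ≤ (N + 1)² avoids a square root.
  have h1 : 2 * b * r * x ≤ κ / 2 * x ^ 2 + 2 * b ^ 2 * r ^ 2 / κ := by
    have : κ / 2 * x ^ 2 + 2 * b ^ 2 * r ^ 2 / κ - 2 * b * r * x =
        (κ * x - 2 * b * r) ^ 2 / (2 * κ) := by field_simp; ring
    have : 0 ≤ (κ * x - 2 * b * r) ^ 2 / (2 * κ) := by positivity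
    linarith
  have h2 : x ^ 2 ≤ N * r ^ 2 := by
    have e1 : N * r ^ 2 = 2 / κ * (2 * b ^ 2 * r ^ 2 / κ + b ^ 2 * r ^ 2) := by
      rw [hNdef]; field_simp
    rw [e1, div_mul_eq_mul_div, le_div_iff₀ hκ]
    linarith
  refine le_of_sq_le_sq (h2.trans ?_) (by positivity)
  rw [mul_pow]
  gcongr
  nlinarith

set_option maxHeartbeats 400000 in
lemma recovery_uniform {ε₁ ε₂ a b δ : ℝ} (hε₁ : 0 < ε₁) (hε : ε₁ ≤ ε₂) (hab : a ≤ b)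
    (ha : regThreshold ε₂ ≤ a) (hδ : 0 < δ) :
    ∃ M r₀ : ℝ, 0 < M ∧ 0 < r₀ ∧
      ∀ (lam : ℝ) (d s m : ℕ) (ρ : ℝ), 0 < lam → 2 ≤ d → 1 ≤ m → rate d s m lam ≤ r₀ →
        a * Real.sqrt (Real.log d / m) ≤ ρ → ρ ≤ b * Real.sqrt (Real.log d / m) →
        ∀ S : Mat d, TrueModel ε₁ ε₂ s S →
        ∀ (Ω : Type u) [MeasurableSpace Ω] (P : Measure Ω) [IsProbabilityMeasure P]
          (ν : EuclideanSpace ℝ (Fin d)) (X : Fin m → Ω → EuclideanSpace ℝ (Fin d)),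
          IsGaussianSample P ν S X →
          P {ω | ¬ ∀ p, IsPenaltyMin (sampleCov fun l => X l ω) ρ lam (sym d) p →
              frob (p.1 - S⁻¹) ≤ M * rate d s m lam}
            ≤ ENNReal.ofReal δ := by
  have hε₂ : 0 < ε₂ := hε₁.trans_le hε
  have ha₀ := regThreshold_pos hε₂
  set a₀ := regThreshold ε₂ with ha₀def
  have ha0 : 0 < a := ha₀.trans_le ha
  have hb : 0 < b := ha0.trans_le hab
  obtain ⟨K, hK0, hK⟩ := exists_level hε₂ δ
  set κ := ε₁ ^ 2 / (1 + ε₁) with hκdef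
  have hκ : 0 < κ := by positivity
  set D := 8 / δ with hD
  have hD0 : 0 < D := by positivity
  set N := 2 * b + b ^ 2 + (K + b) * Real.sqrt D + a₀ + K + 1 with hN
  have hN0 : 0 < N := by positivity
  set μ := min (min (κ / 2) (tailRange ε₂)) 1 with hμ
  have hμ0 : 0 < μ := lt_min (lt_min (by positivity) (tailRange_pos hε₂)) one_pos
  have hμ1 : μ ≤ κ / 2 := (min_le_left _ _).trans (min_le_left _ _)
  have hμ2 : μ ≤ tailRange ε₂ := (min_le_left _ _).trans (min_le_right _ _)
  have hμ3 : μ ≤ 1 := min_le_right _ _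
  set M₁ := 2 / κ * (2 * b ^ 2 / κ + b ^ 2) + 1 with hM₁
  set M₂ := (K + b) * Real.sqrt D / κ with hM₂
  have hM₁0 : 0 < M₁ := by positivity
  have hM₂0 : 0 < M₂ := by positivity
  refine ⟨M₁ + M₂, μ / N, by positivity, by positivity,
    fun lam d s m ρ hlam hd hm hr hρa hρb S hS Ω _ P _ ν X hX => ?_⟩
  set r := rate d s m lam with hrdef
  set q := Real.sqrt (Real.log d / m) with hq
  have hq0 : 0 ≤ q := Real.sqrt_nonneg _
  have hr0 : 0 ≤ r := rate_nonneg _ _ _ _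
  have hρ : 0 ≤ ρ := (mul_nonneg ha0.le hq0).trans hρa
  have hNr : N * r ≤ μ := by rwa [le_div_iff₀' hN0] at hr
  have hNr' : 2 * b * r + b ^ 2 * r + (K + b) * Real.sqrt D * r + a₀ * r + K * r + r ≤ μ := by
    calc _ = N * r := by rw [hN]; ring
      _ ≤ μ := hNr
  have p1 : 0 ≤ 2 * b * r := by positivity
  have p2 : 0 ≤ b ^ 2 * r := by positivity
  have p3 : 0 ≤ (K + b) * Real.sqrt D * r := by positivity
  have p4 : 0 ≤ a₀ * r := by positivity
  have p5 : 0 ≤ K * r := by positivity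
  have hr1 : r ≤ 1 := by linarith
  obtain ⟨hqs, hdq⟩ := rate_bounds (s := s) (m := m) hd hlam
  rw [← hq, ← hrdef] at hqs hdq
  have hqr : q ≤ r := sqrt_log_div_le_rate hd hlam
  have hS₀ := hS.posDef hε₁
  -- At the level a₀ one has `tailRate ε₂` · a₀² = 3, so noise exceeds a₀q ≤ ρ with probability at
  -- most 8d² · d⁻³ = 8/d. This is at most δ only for d ≥ D = 8/δ, where the sparse estimate
  -- applies. Smaller dimensions are bounded in terms of δ, and there the dense estimate loses only
  -- a factor √D.
  by_cases hdD : D ≤ d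
  · have hlev : Real.log (8 / δ) ≤ (tailRate ε₂ * a₀ ^ 2 - 2) * Real.log d := by
      have hc := tailRate_pos hε₂
      rw [ha₀def, regThreshold, Real.sq_sqrt (by positivity), mul_div_cancel₀ _ hc.ne']
      have := Real.log_le_log hD0 hdD
      linarith
    have haq : a₀ * q ≤ a₀ * r := by gcongr
    refine le_trans (measure_mono ?_) (hX.measure_deviation_le_of_log hS₀.posSemidef hε₂
      hS.sub_posSemidef hm hd hδ ha₀.le hlev (by linarith))
    intro ω hω hW
    refine hω fun p hp => ?_
    have hfix := hp.isFixed hρ hlam (isSymm_sampleCov fun l => X l ω)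
    have hβ : 2 * ρ * Real.sqrt (d + s) ≤ 2 * b * r := by
      calc 2 * ρ * Real.sqrt (d + s) ≤ 2 * (b * q) * Real.sqrt (d + s) := by gcongr
        _ = 2 * b * (q * Real.sqrt (d + s)) := by ring
        _ ≤ _ := by gcongr
    have hγ : d ^ 2 * ρ ^ 2 / lam ≤ b ^ 2 * r ^ 2 := by
      rw [div_le_iff₀ hlam]
      calc (d : ℝ) ^ 2 * ρ ^ 2 ≤ d ^ 2 * (b * q) ^ 2 := by gcongr
        _ = b ^ 2 * (d * q) ^ 2 := by ring
        _ ≤ b ^ 2 * (Real.sqrt lam * r) ^ 2 := by gcongr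
        _ = _ := by rw [mul_pow, Real.sq_sqrt hlam.le]; ring
    have hr2 : b ^ 2 * r ^ 2 ≤ b ^ 2 * r := by
      have : r ^ 2 ≤ r := by nlinarith
      gcongr
    have h1 := hfix.frob_sub_le_sparse hρ hlam hS₀ hε₁ hS.posSemidef_sub
      (fun i j => (hW i j).trans (le_trans (by gcongr) hρa)) hS.sparse (by linarith)
    have hx := frob_nonneg (p.1 - S⁻¹)
    have h2 := le_of_quadratic (b := b) hκ hr0 (x := frob (p.1 - S⁻¹))
      (h1.trans (add_le_add (mul_le_mul_of_nonneg_right hβ hx) hγ))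
    exact h2.trans (mul_le_mul_of_nonneg_right (by linarith) hr0)
  · have hKq : K * q ≤ K * r := by gcongr
    refine le_trans (measure_mono ?_) (hX.measure_deviation_le_of_log hS₀.posSemidef hε₂
      hS.sub_posSemidef hm hd hδ hK0.le (hK d hd) (by linarith))
    intro ω hω hW
    refine hω fun p hp => ?_
    have hfix := hp.isFixed hρ hlam (isSymm_sampleCov fun l => X l ω)
    have hdr : d * q ≤ Real.sqrt D * r := by
      calc (d : ℝ) * q = Real.sqrt d * (q * Real.sqrt d) := by
            nth_rw 1 [← Real.mul_self_sqrt (Nat.cast_nonneg (α := ℝ) d)]; ring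
        _ ≤ Real.sqrt D * (q * Real.sqrt (d + s)) := by
            gcongr
            · exact (not_le.1 hdD).le
            · linarith [Nat.cast_nonneg (α := ℝ) s]
        _ ≤ _ := by gcongr
    have hsum : d * (K * q + ρ) ≤ (K + b) * Real.sqrt D * r := by
      calc d * (K * q + ρ) ≤ d * (K * q + b * q) := by gcongr
        _ = (K + b) * (d * q) := by ring
        _ ≤ (K + b) * (Real.sqrt D * r) := by gcongr
        _ = _ := by ring
    obtain ⟨_, hx2⟩ := hfix.frob_sub_le_dense hρ hlam hS₀ hε₁ hS.posSemidef_sub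
      (mul_nonneg hK0.le hq0) hW (by linarith)
    have h2 : frob (p.1 - S⁻¹) ≤ M₂ * r := by
      rw [hM₂, div_mul_eq_mul_div, le_div_iff₀ hκ]
      linarith
    exact h2.trans (mul_le_mul_of_nonneg_right (by linarith) hr0)

end

end GLAD

/-! ### Assembly of the theorem. -/

open GLAD in
theorem theorem1 (ε₁ ε₂ c z₀ : ℝ) (hε₁ : 0 < ε₁) (hε : ε₁ ≤ ε₂) (hz₀ : 0 ≤ z₀) :
    -- linear convergence of alternating minimization for the quadratic-penalty objective
    (∀ (d : ℕ) (ρ lam : ℝ), 0 < ρ → 0 < lam →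
      ∃ C : ℝ, 0 < C ∧ C < 1 ∧
        ∀ S : Mat d, S.PosSemidef → specNorm S ≤ c →
          (∃! p, IsPenaltyMin S ρ lam (sym d) p) ∧
          (∀ p, IsPenaltyMin S ρ lam (spd d) p → IsPenaltyMin S ρ lam (sym d) p) ∧
          ∀ p, IsPenaltyMin S ρ lam (sym d) p →
            ∀ Θ Z : ℕ → Mat d, IsAM S ρ lam Θ Z → Z 0 ∈ sym d → specNorm (Z 0) ≤ z₀ →
              ∀ k, frob (Z (k + 1) - p.2) ≤ frob (Θ (k + 1) - p.1) ∧
                frob (Θ (k + 1) - p.1) ≤ C * frob (Z k - p.2)) ∧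
    ∃ (C : ℝ → ℝ) (a₀ : ℝ), (∀ lam, 0 < lam → 0 < C lam ∧ C lam < 1) ∧ 0 < a₀ ∧
      ∀ a b δ : ℝ, 0 < a → a ≤ b → 0 < δ →
        -- the `k`-th iterate, with a contraction factor `C lam` that depends on `lam` only
        (∃ M : ℝ → ℝ, (∀ lam, 0 < lam → 0 < M lam) ∧
          (a₀ ≤ a → ∀ lam lam', 0 < lam → 0 < lam' → M lam = M lam') ∧
          ∀ lam, 0 < lam → ∃ r₀ : ℝ, 0 < r₀ ∧
            ∀ (d s m : ℕ) (ρ : ℝ), 2 ≤ d → 1 ≤ m → rate d s m lam ≤ r₀ →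
              a * Real.sqrt (Real.log d / m) ≤ ρ → ρ ≤ b * Real.sqrt (Real.log d / m) →
              ∀ S : Mat d, TrueModel ε₁ ε₂ s S →
              ∀ (Ω : Type*) [MeasurableSpace Ω] (P : Measure Ω) [IsProbabilityMeasure P]
                (ν : EuclideanSpace ℝ (Fin d)) (X : Fin m → Ω → EuclideanSpace ℝ (Fin d)),
                IsGaussianSample P ν S X →
                P {ω | ¬ ∀ p, IsPenaltyMin (sampleCov fun l => X l ω) ρ lam (sym d) p →
                  ∀ Θ Z : ℕ → Mat d, IsAM (sampleCov fun l => X l ω) ρ lam Θ Z →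
                    Z 0 ∈ sym d → specNorm (Z 0) ≤ z₀ →
                    ∀ k, (1 ≤ k ∨ Z 0 = softThreshold (ρ / lam) (Θ 0)) →
                      frob (Θ (k + 1) - p.1) ≤ C lam * frob (Θ k - p.1) ∧
                      frob (Θ (k + 1) - S⁻¹) ≤
                        C lam * frob (Θ k - p.1) + M lam * rate d s m lam}
                  ≤ ENNReal.ofReal δ) ∧
        -- the error term, uniformly in `lam`
        (a₀ ≤ a → ∃ M r₀ : ℝ, 0 < M ∧ 0 < r₀ ∧
          ∀ (lam : ℝ) (d s m : ℕ) (ρ : ℝ), 0 < lam → 2 ≤ d → 1 ≤ m → rate d s m lam ≤ r₀ →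
            a * Real.sqrt (Real.log d / m) ≤ ρ → ρ ≤ b * Real.sqrt (Real.log d / m) →
            ∀ S : Mat d, TrueModel ε₁ ε₂ s S →
            ∀ (Ω : Type*) [MeasurableSpace Ω] (P : Measure Ω) [IsProbabilityMeasure P]
              (ν : EuclideanSpace ℝ (Fin d)) (X : Fin m → Ω → EuclideanSpace ℝ (Fin d)),
              IsGaussianSample P ν S X →
              P {ω | ¬ ∀ p, IsPenaltyMin (sampleCov fun l => X l ω) ρ lam (sym d) p →
                  frob (p.1 - S⁻¹) ≤ M * rate d s m lam}
                ≤ ENNReal.ofReal δ) := by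
  have hε₂ : 0 < ε₂ := hε₁.trans_le hε
  refine ⟨fun d ρ lam hρ hlam => ?_, amFactor ε₁ z₀, regThreshold ε₂, fun lam hlam =>
    ⟨contraction_factor_pos hlam, contraction_factor_lt_one hlam (by positivity)⟩,
    regThreshold_pos hε₂, fun a b δ ha hab hδ =>
    ⟨?_, fun h => recovery_uniform hε₁ hε hab h hδ⟩⟩
  · obtain ⟨C, hC0, hC1, hC⟩ := linear_convergence c z₀ hz₀ d hρ hlam
    refine ⟨C, hC0, hC1, fun S hS hSc => ⟨?_, fun p hp => ?_, hC S hS hSc⟩⟩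
    · obtain ⟨p, hp⟩ := exists_isPenaltyMin hS hρ hlam
      have hSs := isSymm_of_posSemidef hS
      exact ⟨p, hp, fun q hq =>
        (hq.isFixed hρ.le hlam hSs).unique hρ.le hlam (hp.isFixed hρ.le hlam hSs)⟩
    · exact (isFixed_iff_isPenaltyMin hS hρ hlam).1
        (hp.isFixed_of_spd hρ.le hlam (isSymm_of_posSemidef hS))
  have hb : 0 < b := ha.trans_le hab
  have hδ2 : 0 < δ / 2 := half_pos hδ
  choose! M₁ r₁ hM₁ hr₁ hfixed using fun (lam : ℝ) (hlam : 0 < lam) =>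
    recovery_fixed_lam hε₁ hε hz₀ hb hδ2 hlam
  -- Above the threshold, M comes from the uniform bound and only r₀ depends on λ, through the
  -- contraction event; δ is split between the two events. Below it, the constant for fixed λ is
  -- used.
  by_cases h : regThreshold ε₂ ≤ a
  · obtain ⟨M, r₀, hM, hr₀, hunif⟩ := recovery_uniform hε₁ hε hab h hδ2
    refine ⟨fun _ => M, fun _ _ => hM, fun _ _ _ _ _ => rfl, fun lam hlam =>
      ⟨min (r₁ lam) r₀, lt_min (hr₁ lam hlam) hr₀,
      fun d s m ρ hd hm hr hρa hρb S hS Ω _ P _ ν X hX => ?_⟩⟩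
    have hρ : 0 ≤ ρ := (mul_nonneg ha.le (Real.sqrt_nonneg _)).trans hρa
    have e1 := hfixed lam hlam d s m ρ hd hm (hr.trans (min_le_left _ _)) hρ hρb S hS Ω P ν X hX
    have e2 := hunif lam d s m ρ hlam hd hm (hr.trans (min_le_right _ _)) hρa hρb S hS Ω P ν X hX
    have e3 : ENNReal.ofReal δ = ENNReal.ofReal (δ / 2) + ENNReal.ofReal (δ / 2) := by
      rw [← ENNReal.ofReal_add hδ2.le hδ2.le, add_halves]
    rw [e3]
    refine le_trans (measure_mono ?_) ((measure_union_le _ _).trans (add_le_add e1 e2))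
    intro ω hω
    by_contra hn
    rw [Set.mem_union, not_or] at hn
    obtain ⟨h1, h2⟩ := hn
    refine hω fun p hp Θ Z hAM hZs hZ k hk => ?_
    have h3 := (not_not.1 h1 p hp).2 Θ Z hAM hZs hZ k hk
    have h4 := not_not.1 h2 p hp
    exact ⟨h3, (frob_sub_le _ p.1 _).trans (add_le_add h3 h4)⟩
  · refine ⟨M₁, hM₁, fun h' => absurd h' h, fun lam hlam =>
      ⟨r₁ lam, hr₁ lam hlam, fun d s m ρ hd hm hr hρa hρb S hS Ω _ P _ ν X hX => ?_⟩⟩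
    have hρ : 0 ≤ ρ := (mul_nonneg ha.le (Real.sqrt_nonneg _)).trans hρa
    refine le_trans (measure_mono ?_) ((hfixed lam hlam d s m ρ hd hm hr hρ hρb S hS Ω P ν X
      hX).trans (ENNReal.ofReal_le_ofReal (half_le_self hδ.le)))
    intro ω hω hgood
    refine hω fun p hp Θ Z hAM hZs hZ k hk => ?_
    obtain ⟨h4, h5⟩ := hgood p hp
    have h3 := h5 Θ Z hAM hZs hZ k hk
    exact ⟨h3, (frob_sub_le _ p.1 _).trans (add_le_add h3 h4)⟩
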